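/- Let $m\ge 0$ and $n\ge 2$. For each $i=1,\dots,m$ let there be given score vectors $\mathbf a_i,\mathbf b_i\in\mathbb R_{\ge 0}^n$, a weight vector $\mathbf w_i=(w_{i1},\dots,w_{in})$ with $w_{i1}\ge w_{i2}\ge\dots\ge w_{in}\ge 0$, and a function $f_i(\alpha,\beta)$; let $F(\alpha,\beta)$ be a further function. For a permutation (ranking) $\pi$ of $[n]$ put $\mathsf{cs}_{\mathbf v}(\mathbf c,\pi)=\sum_{j=1}^n v_j c_{\pi(j)}$. For weight vectors $\mathbf v=(\mathbf v_1,\dots,\mathbf v_m)$ and rankings $\pi=(\pi_1,\dots,\pi_m)$ define the combined objective $$\mathsf{co}_{\mathbf v}(\pi)=F\Big(\sum_{i=1}^m \mathsf{cs}_{\mathbf v_i}(\mathbf a_i,\pi_i),\ \sum_{i=1}^m \mathsf{cs}_{\mathbf v_i}(\mathbf b_i,\pi_i)\Big)+\sum_{i=1}^m f_i\big(\mathsf{cs}_{\mathbf v_i}(\mathbf a_i,\pi_i),\ \mathsf{cs}_{\mathbf v_i}(\mathbf b_i,\pi_i)\big).$$ Assume that each of $f_1,\dots,f_m,F$ is concave,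 strictly increasing in each coordinate and continuously differentiable on its domain, which is either $\{\alpha,\beta\ge 0\}$ or $\{\alpha,\beta>0\}$ (in the latter case, the score pairs at which it is evaluated for the weights $\mathbf w$ are assumed to be positive for all rankings). Then there is a deterministic polynomial-time algorithm that, given $\mathbf a,\mathbf b,\mathbf w$ and oracle access to the values and gradients of $f_1,\dots,f_m,F$, outputs rankings $\pi=(\pi_1,\dots,\pi_m)$ such that $$\mathsf{co}_{\mathbf w'}(\pi)\ \ge\ \max_{\sigma=(\sigma_1,\dots,\sigma_m)}\mathsf{co}_{\mathbf w}(\sigma)$$ for some $\mathbf w'=(\mathbf w'_1,\dots,\mathbf w'_m)$ with $\mathbf w'_i=\mathbf w_i+(w_{i,t_i}-w_{i,t_i+1})\,\mathbf e_{t_i+1}$, $t_i\in\{1,\dots,n-1\}$, i.e. $\mathbf w_i'$ is obtained from $\mathbf w_i$ by replacing $w_{i,t_i+1}$ with $w_{i,t_i}$. Here polynomial time means: there are one fixed program and one polynomial $T$ such that on all such inputs the program halts after at most $T(m+n)$ steps, where an exact arithmetic operation or comparison of real numbers, an elementary pointer operation, and an oracle query each count as one step. -/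

import Mathlib

namespace MultiRank

/-! ### The optimization problem -/

/-- The cumulative score of a ranking `π` (position `j` shows the result `π j`). -/
def cs {n : ℕ} (w a : Fin n → ℝ) (π : Equiv.Perm (Fin n)) : ℝ :=
  ∑ j, w j * a (π j)

/-- The data of `m` ranking instances on `n` results each: scores `a`, `b`, weights `w`,
local functions `f i` and the global function `F`, together with the gradients of the functions
(that these are the gradients is part of `Instance.Valid`). -/
structure Instance (m n : ℕ) where
  a : Fin m → Fin n → ℝ
  b : Fin m → Fin n → ℝ
  w : Fin m → Fin n → ℝ
  f : Fin m → ℝ × ℝ → ℝ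
  gradf : Fin m → ℝ × ℝ → ℝ × ℝ
  F : ℝ × ℝ → ℝ
  gradF : ℝ × ℝ → ℝ × ℝ

namespace Instance

variable {m n : ℕ} (I : Instance m n)

/-- The pair (cumulative `a`-score, cumulative `b`-score) of the `i`-th instance for the weight
vectors `v`. -/
def scores (v : Fin m → Fin n → ℝ) (π : Fin m → Equiv.Perm (Fin n)) (i : Fin m) : ℝ × ℝ :=
  (cs (v i) (I.a i) (π i), cs (v i) (I.b i) (π i))

/-- The pair of global cumulative scores. -/
def globalScores (v : Fin m → Fin n → ℝ) (π : Fin m → Equiv.Perm (Fin n)) : ℝ × ℝ :=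
  (∑ i, cs (v i) (I.a i) (π i), ∑ i, cs (v i) (I.b i) (π i))

/-- The combined objective of the sequence of rankings `π` for the weight vectors `v`. -/
def co (v : Fin m → Fin n → ℝ) (π : Fin m → Equiv.Perm (Fin n)) : ℝ :=
  I.F (I.globalScores v π) + ∑ i, I.f i (I.scores v π i)

/-- The maximum of the combined objective over all sequences of rankings. -/
noncomputable def coStar (v : Fin m → Fin n → ℝ) : ℝ :=
  (Finset.univ : Finset (Fin m → Equiv.Perm (Fin n))).sup' Finset.univ_nonempty (I.co v)

end Instance

/-- `w + (w_t - w_{t+1}) e_{t+1}`: the coordinate `w_{t+1}` is replaced with `w_t`. -/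
def raise {n : ℕ} (w : Fin n → ℝ) (t : Fin (n - 1)) : Fin n → ℝ :=
  w + (w ⟨t, by omega⟩ - w ⟨t + 1, by omega⟩) • Pi.single (⟨t + 1, by omega⟩ : Fin n) (1 : ℝ)

/-- The possible domains of the objective functions: the closed quadrant `α, β ≥ 0`, or the open
quadrant `α, β > 0` (as for `log α + log β`). -/
def IsQuadrant (D : Set (ℝ × ℝ)) : Prop :=
  D = Set.Ici 0 ×ˢ Set.Ici 0 ∨ D = Set.Ioi 0 ×ˢ Set.Ioi 0

/-- `f` is concave, strictly increasing in each coordinate and continuously differentiable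
on `D`, with gradient `g` (one-sided derivatives at boundary points that belong to `D`). -/
structure IsObjectiveOn (D : Set (ℝ × ℝ)) (f : ℝ × ℝ → ℝ) (g : ℝ × ℝ → ℝ × ℝ) : Prop where
  concave : ConcaveOn ℝ D f
  strictMono_fst : ∀ x x' y : ℝ, (x, y) ∈ D → (x', y) ∈ D → x < x' → f (x, y) < f (x', y)
  strictMono_snd : ∀ x y y' : ℝ, (x, y) ∈ D → (x, y') ∈ D → y < y' → f (x, y) < f (x, y')
  hasGrad : ∀ z ∈ D, HasFDerivWithinAt f
    ((g z).1 • ContinuousLinearMap.fst ℝ ℝ ℝ + (g z).2 • ContinuousLinearMap.snd ℝ ℝ ℝ) D z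
  contGrad : ContinuousOn g D

/-- The assumptions on the data. Every function has its own domain, a closed or an open quadrant,
which has to contain the scores at which the function is evaluated. -/
structure Instance.Valid {m n : ℕ} (I : Instance m n) : Prop where
  two_le : 2 ≤ n
  a_nonneg : ∀ i j, 0 ≤ I.a i j
  b_nonneg : ∀ i j, 0 ≤ I.b i j
  w_antitone : ∀ i, Antitone (I.w i)
  w_nonneg : ∀ i j, 0 ≤ I.w i j
  objective_f : ∀ i, ∃ D, IsQuadrant D ∧ IsObjectiveOn D (I.f i) (I.gradf i) ∧
    ∀ π, I.scores I.w π i ∈ D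
  objective_F : ∃ D, IsQuadrant D ∧ IsObjectiveOn D I.F I.gradF ∧
    ∀ π, I.globalScores I.w π ∈ D

/-! ### The model of computation

A real random access machine with unit cost for exact arithmetic operations and comparisons of real
numbers, whose storage consists of cells that hold a real number or a pair of pointers, and whose
programs are structured. A program is a fixed finite object; its only numerical constant is `1`.
Objective functions are accessed by an oracle, also at unit cost. -/

/-- The values that programs compute with: the empty value, a real number, or a pair. -/
inductive Data where
  | nil : Data
  | num (x : ℝ) : Data
  | pair (l r : Data) : Data

namespace Data

/-- Lists are right-nested pairs, ended by `nil`. -/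
def ofList : List Data → Data
  | [] => nil
  | x :: l => pair x (ofList l)

/-- Natural numbers are in unary. -/
def numeral (k : ℕ) : Data := ofList (List.replicate k nil)

/-- The length of a list, hence the value of a numeral. -/
def length : Data → ℕ
  | pair _ r => r.length + 1
  | _ => 0

end Data

/-- The answer of an oracle to the query of the function with the given number at a point. -/
abbrev Oracle := ℕ → ℝ × ℝ → Data

/-- The elementary operations. -/
inductive Op where
  | id | nil | one | fst | snd | add | sub | mul | div | lt | query

open Classical in
/-- The effect of an elementary operation; malformed arguments give `nil`. The value `nil` means
false and all other values mean true. -/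
noncomputable def Op.eval (O : Oracle) : Op → Data → Data
  | .id, d => d
  | .nil, _ => .nil
  | .one, _ => .num 1
  | .fst, .pair l _ => l
  | .snd, .pair _ r => r
  | .add, .pair (.num x) (.num y) => .num (x + y)
  | .sub, .pair (.num x) (.num y) => .num (x - y)
  | .mul, .pair (.num x) (.num y) => .num (x * y)
  | .div, .pair (.num x) (.num y) => .num (x / y)
  | .lt, .pair (.num x) (.num y) => if x < y then .pair .nil .nil else .nil
  | .query, .pair k (.pair (.num x) (.num y)) => O k.length (x, y)
  | _, _ => .nil

/-- Programs. -/
inductive Prog where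
  | op (o : Op) : Prog
  | pair (p q : Prog) : Prog
  | seq (p q : Prog) : Prog
  | ite (c p q : Prog) : Prog
  | loop (c p : Prog) : Prog

/-- `Run O p x y k`: with the oracle `O`, the program `p` on the input `x` halts with the output `y`
after exactly `k` steps. -/
inductive Run (O : Oracle) : Prog → Data → Data → ℕ → Prop where
  | op (o : Op) (x : Data) : Run O (.op o) x (o.eval O x) 1
  | pair {p q : Prog} {x y z : Data} {k l : ℕ} :
      Run O p x y k → Run O q x z l → Run O (.pair p q) x (.pair y z) (k + l + 1)
  | seq {p q : Prog} {x y z : Data} {k l : ℕ} :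
      Run O p x y k → Run O q y z l → Run O (.seq p q) x z (k + l + 1)
  | ite_true {c p q : Prog} {x b y : Data} {k l : ℕ} :
      Run O c x b k → b ≠ .nil → Run O p x y l → Run O (.ite c p q) x y (k + l + 1)
  | ite_false {c p q : Prog} {x y : Data} {k l : ℕ} :
      Run O c x .nil k → Run O q x y l → Run O (.ite c p q) x y (k + l + 1)
  | loop_done {c p : Prog} {x : Data} {k : ℕ} :
      Run O c x .nil k → Run O (.loop c p) x x (k + 1)
  | loop_step {c p : Prog} {x b y z : Data} {k l r : ℕ} :
      Run O c x b k → b ≠ .nil → Run O p x y l → Run O (.loop c p) y z r →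
      Run O (.loop c p) x z (k + l + r + 1)

/-! ### Input, oracle and output for the ranking problem -/

/-- A function value together with the gradient. -/
def answer (v : ℝ) (g : ℝ × ℝ) : Data :=
  .pair (.num v) (.pair (.num g.1) (.num g.2))

/-- Number `0` is the global function, number `i + 1` is the `i`-th local function
(`i = 0, …, m - 1`). A query returns the value and the gradient at the given point. -/
def Instance.oracle {m n : ℕ} (I : Instance m n) : Oracle
  | 0, z => answer (I.F z) (I.gradF z)
  | i + 1, z => if h : i < m then answer (I.f ⟨i, h⟩ z) (I.gradf ⟨i, h⟩ z) else .nil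

/-- The input: the list of the `m` instances, each being the list of its `n` triples of numbers
`a i j`, `b i j`, `w i j`. -/
def Instance.input {m n : ℕ} (I : Instance m n) : Data :=
  .ofList (List.ofFn fun i => .ofList (List.ofFn fun j =>
    .pair (.num (I.a i j)) (.pair (.num (I.b i j)) (.num (I.w i j)))))

/-- The output: the list of the `m` rankings, each being the list `π i 0, …, π i (n - 1)`. -/
def output {m n : ℕ} (π : Fin m → Equiv.Perm (Fin n)) : Data :=
  .ofList (List.ofFn fun i => .ofList (List.ofFn fun j => .numeral (π i j)))

end MultiRank

/-! The maximum over rankings is bounded by a relaxation: choose a point `x i` in the convex hull of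
the score pairs of each instance and maximize `F (∑ x i) + ∑ f i (x i) + ε * ∑ psi (x i)`. At a
maximizer let `g` be the gradient of `F` at the total. Each `x i` is then a stationary point, on its
own hull, of the field `g + ∇ f i + ε ∇ psi`; strict concavity of `psi` makes the stationary point
unique. So the prices `g` decouple the instances, at an error of at most `ε * M`
(`Instance.Valid.exists_prices`).

For a single instance, the upper right boundary of the hull is traced by the rankings sorted by `a +
τ b` as `τ` grows from 0. Consecutive ones differ by a swap of neighbours (`Chain`), and there are
at most `n * n` swaps. Following a positive continuous field along this chain, one meets either a
ranking that is stationary itself or, by the intermediate value theorem, a stationary point on the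
edge belonging to a swap (`Chain.choose_spec`, `exists_stationary`). A point of that edge is
dominated by the score of the ranking before the swap once the later of the two weights is raised to
the earlier one. This is where the modified weights come from.

The prices are unknown, but the choice of the swap depends only on the signs of the numbers `H ·
(difference of the swapped items)`, where `H` is the field after the swap. These are affine
functions of the three numbers `g.1`, `g.2`, `ε` (`Instance.eval_affOf`). Polynomially many sample
points realize all sign vectors of polynomially many affine functions in fixed dimension
(`exists_mem_samples`). The algorithm therefore evaluates the combined objective with raised weights
for the rankings chosen at every sample point and keeps the best. The candidates do not depend on
`ε`, so letting `ε` tend to 0 removes the error (`Instance.Valid.le_of_sample`).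

The remaining work is to implement this in the machine model. Loop-free programs are evaluated by
`Prog.val`, and loops occur only as folds over lists, whose step bounds are polynomials by
construction (`Comp.fold_prefix`). The final run is `comp_main`. -/

namespace MultiRank

/-! ### Straight-line programs -/

namespace Prog

open Classical in
/-- The output of a program without loops. -/
noncomputable def val (O : Oracle) : Prog → Data → Data
  | op o, x => o.eval O x
  | pair p q, x => .pair (val O p x) (val O q x)
  | seq p q, x => val O q (val O p x)
  | ite c p q, x => if val O c x = .nil then val O q x else val O p x
  | loop _ _, x => x

/-- A program without loops. -/
def Straight : Prog → Prop
  | op _ => True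
  | pair p q => p.Straight ∧ q.Straight
  | seq p q => p.Straight ∧ q.Straight
  | ite c p q => c.Straight ∧ p.Straight ∧ q.Straight
  | loop _ _ => False

/-- A bound on the number of steps of a program without loops. -/
def time : Prog → ℕ
  | op _ => 1
  | pair p q => p.time + q.time + 1
  | seq p q => p.time + q.time + 1
  | ite c p q => c.time + (p.time + q.time) + 1
  | loop _ _ => 0

theorem Straight.run {O : Oracle} : ∀ {p : Prog}, p.Straight → ∀ x,
    ∃ k, Run O p x (p.val O x) k ∧ k ≤ p.time
  | op o, _, x => ⟨1, .op o x, le_rfl⟩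
  | pair _ _, ⟨hp, hq⟩, x => by
    obtain ⟨k, hk, hk'⟩ := hp.run (O := O) x
    obtain ⟨l, hl, hl'⟩ := hq.run (O := O) x
    exact ⟨_, .pair hk hl, by simp only [time]; omega⟩
  | seq p _, ⟨hp, hq⟩, x => by
    obtain ⟨k, hk, hk'⟩ := hp.run (O := O) x
    obtain ⟨l, hl, hl'⟩ := hq.run (O := O) (p.val O x)
    exact ⟨_, .seq hk hl, by simp only [time]; omega⟩
  | ite c _ _, ⟨hc, hp, hq⟩, x => by
    obtain ⟨k, hk, hk'⟩ := hc.run (O := O) x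
    by_cases h : c.val O x = .nil
    · obtain ⟨l, hl, hl'⟩ := hq.run (O := O) x
      refine ⟨k + l + 1, ?_, by simp only [time]; omega⟩
      simp only [val, h, if_true]
      exact .ite_false (h ▸ hk) hl
    · obtain ⟨l, hl, hl'⟩ := hp.run (O := O) x
      refine ⟨k + l + 1, ?_, by simp only [time]; omega⟩
      simp only [val, h, if_false]
      exact .ite_true hk h hl

/-- The first component of the result of a program. -/
abbrev hd (p : Prog) : Prog := .seq p (.op .fst)

/-- The second component of the result of a program. -/
abbrev tl (p : Prog) : Prog := .seq p (.op .snd)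

/-- The application of a binary operation to the results of two programs. -/
abbrev bin (o : Op) (p q : Prog) : Prog := .seq (.pair p q) (.op o)

/-- The constant `nil`. -/
abbrev none : Prog := .op .nil

/-- The `k`-th entry of the environment. -/
def var : ℕ → Prog
  | 0 => .op .fst
  | k + 1 => .seq (.op .snd) (var k)

@[simp]
theorem straight_var : ∀ k, (var k).Straight
  | 0 => trivial
  | k + 1 => ⟨trivial, straight_var k⟩

@[simp]
theorem val_var_zero (O : Oracle) (x y : Data) : (var 0).val O (.pair x y) = x := rfl

@[simp]
theorem val_var_succ (O : Oracle) (k : ℕ) (x y : Data) :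
    (var (k + 1)).val O (.pair x y) = (var k).val O y := rfl

/-- The constant zero. -/
abbrev zero : Prog := bin .sub (.op .one) (.op .one)

end Prog

/-! ### Programs with polynomial step bounds -/

/-- A program together with a bound on the number of its steps in terms of the size of the
input. -/
structure Code where
  prog : Prog
  cost : Polynomial ℕ

/-- For inputs of size `s`, the code `c` computes `y` from `x` within its step bound. -/
def Comp (O : Oracle) (s : ℕ) (c : Code) (x y : Data) : Prop :=
  ∃ k, Run O c.prog x y k ∧ k ≤ c.cost.eval s

namespace Code

/-- A program without loops. -/
noncomputable def straight (p : Prog) : Code := ⟨p, Polynomial.C p.time⟩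

/-- Composition. -/
noncomputable def seq (c d : Code) : Code := ⟨.seq c.prog d.prog, c.cost + d.cost + 1⟩

/-- Pairing. -/
noncomputable def pair (c d : Code) : Code := ⟨.pair c.prog d.prog, c.cost + d.cost + 1⟩

/-- Case distinction by a program without loops. -/
noncomputable def ite (p : Prog) (c d : Code) : Code :=
  ⟨.ite p c.prog d.prog, Polynomial.C p.time + (c.cost + d.cost) + 1⟩

/-- Extend the environment by the result of `c`, then run `d`. -/
noncomputable def bind (c d : Code) : Code := (c.pair (straight (.op .id))).seq d

/-- Run the program `body` for every element of a list, starting from the value of `init`. The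
input of `body` is the element, the current value and the environment; the output is the new
value. The list has at most `len` elements. -/
noncomputable def fold (len : Polynomial ℕ) (list init body : Code) : Code where
  prog := .seq (.pair list.prog (.pair init.prog (.op .id)))
    (.seq
      -- The loop state consists of the remaining list, the current value and the environment. An
      -- exhausted list is `nil`, which serves as the stopping test.
      (.loop (.op .fst)
        (.pair (.tl (.op .fst))
          (.pair (.seq (.pair (.hd (.op .fst)) (.op .snd)) body.prog) (.tl (.op .snd)))))
      (.hd (.op .snd)))
  cost := list.cost + init.cost + len * (body.cost + 20) + 20

end Code

namespace Comp

variable {O : Oracle} {s : ℕ}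

theorem straight {p : Prog} (hp : p.Straight) {x y : Data} (h : p.val O x = y) :
    Comp O s (.straight p) x y := by
  obtain ⟨k, hk, hk'⟩ := hp.run (O := O) x
  exact ⟨k, h ▸ hk, by simpa [Code.straight] using hk'⟩

theorem seq {c d : Code} {x y z : Data} (hc : Comp O s c x y) (hd : Comp O s d y z) :
    Comp O s (c.seq d) x z := by
  obtain ⟨k, hk, hk'⟩ := hc
  obtain ⟨l, hl, hl'⟩ := hd
  refine ⟨_, .seq hk hl, ?_⟩
  simp only [Code.seq, Polynomial.eval_add, Polynomial.eval_one]
  omega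

theorem pair {c d : Code} {x y z : Data} (hc : Comp O s c x y) (hd : Comp O s d x z) :
    Comp O s (c.pair d) x (.pair y z) := by
  obtain ⟨k, hk, hk'⟩ := hc
  obtain ⟨l, hl, hl'⟩ := hd
  refine ⟨_, .pair hk hl, ?_⟩
  simp only [Code.pair, Polynomial.eval_add, Polynomial.eval_one]
  omega

/-- The environment is a stack: each `bind` pushes its result, so `var k` refers to the result
pushed `k` binds ago. -/
theorem bind {c d : Code} {x y z : Data} (hc : Comp O s c x y) (hd : Comp O s d (.pair y x) z) :
    Comp O s (c.bind d) x z :=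
  (hc.pair (straight (p := .op .id) trivial rfl)).seq hd

theorem ite_true {p : Prog} {c d : Code} {x y : Data} (hp : p.Straight) (h : p.val O x ≠ .nil)
    (hc : Comp O s c x y) : Comp O s (.ite p c d) x y := by
  obtain ⟨k, hk, hk'⟩ := hp.run (O := O) x
  obtain ⟨l, hl, hl'⟩ := hc
  refine ⟨_, .ite_true hk h hl, ?_⟩
  simp only [Code.ite, Polynomial.eval_add, Polynomial.eval_one, Polynomial.eval_C]
  omega

theorem ite_false {p : Prog} {c d : Code} {x y : Data} (hp : p.Straight) (h : p.val O x = .nil)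
    (hd : Comp O s d x y) : Comp O s (.ite p c d) x y := by
  obtain ⟨k, hk, hk'⟩ := hp.run (O := O) x
  obtain ⟨l, hl, hl'⟩ := hd
  refine ⟨_, .ite_false (h ▸ hk) hl, ?_⟩
  simp only [Code.ite, Polynomial.eval_add, Polynomial.eval_one, Polynomial.eval_C]
  omega

/-- A fold whose value after the elements `l₁` is `G l₁`. -/
theorem fold_prefix {α : Type*} {len : Polynomial ℕ} {list init body : Code} {env : Data}
    (f : α → Data) (G : List α → Data) {l : List α}
    (hlist : Comp O s list env (.ofList (l.map f))) (hlen : l.length ≤ len.eval s)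
    (hinit : Comp O s init env (G []))
    (hbody : ∀ l₁ a l₂, l = l₁ ++ a :: l₂ →
      Comp O s body (.pair (f a) (.pair (G l₁) env)) (G (l₁ ++ [a]))) :
    Comp O s (.fold len list init body) env (G l) := by
  obtain ⟨k₁, hk₁, hk₁'⟩ := hlist
  obtain ⟨k₂, hk₂, hk₂'⟩ := hinit
  have loop : ∀ l₂ l₁ : List α, l = l₁ ++ l₂ →
      ∃ k, Run O (.loop (.op .fst)
        (.pair (.tl (.op .fst))
          (.pair (.seq (.pair (.hd (.op .fst)) (.op .snd)) body.prog) (.tl (.op .snd)))))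
        (.pair (.ofList (l₂.map f)) (.pair (G l₁) env)) (.pair .nil (.pair (G l) env)) k
        ∧ k ≤ l₂.length * (body.cost.eval s + 20) + 2 := by
    intro l₂
    induction l₂ with
    | nil =>
      intro l₁ h
      rw [List.append_nil] at h
      exact ⟨2, h ▸ .loop_done (.op .fst _), by simp⟩
    | cons a l₂ ih =>
      intro l₁ h
      obtain ⟨k, hk, hk'⟩ := hbody l₁ a l₂ h
      obtain ⟨r, hr, hr'⟩ := ih (l₁ ++ [a]) (by simpa using h)
      refine ⟨_, .loop_step (.op .fst _) (by simp [Op.eval, Data.ofList])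
        (.pair (.seq (.op .fst _) (.op .snd _))
          (.pair (.seq (.pair (.seq (.op .fst _) (.op .fst _)) (.op .snd _)) hk)
            (.seq (.op .snd _) (.op .snd _)))) hr, ?_⟩
      simp only [List.length_cons]
      have : (l₂.length + 1) * (body.cost.eval s + 20)
        = l₂.length * (body.cost.eval s + 20) + (body.cost.eval s + 20) := by ring
      omega
  obtain ⟨k, hk, hk'⟩ := loop l [] rfl
  refine ⟨_, .seq (.pair hk₁ (.pair hk₂ (.op .id _)))
    (.seq hk (.seq (.op .snd _) (.op .fst _))), ?_⟩
  have := Nat.mul_le_mul_right (body.cost.eval s + 20) hlen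
  simp only [Code.fold, Polynomial.eval_add, Polynomial.eval_mul, Polynomial.eval_ofNat]
  omega

/-- A fold with an invariant. -/
theorem fold_inv {α β : Type*} {len : Polynomial ℕ} {list init body : Code} {env : Data}
    (f : α → Data) (g : β → Data) (step : β → α → β) (P : β → Prop) {l : List α} {b : β}
    (hlist : Comp O s list env (.ofList (l.map f))) (hlen : l.length ≤ len.eval s)
    (hinit : Comp O s init env (g b)) (hb : P b)
    (hbody : ∀ b, ∀ a ∈ l, P b →
      P (step b a) ∧ Comp O s body (.pair (f a) (.pair (g b) env)) (g (step b a))) :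
    Comp O s (.fold len list init body) env (g (l.foldl step b)) := by
  -- The invariant is carried along prefixes of `l`, because the body is only known to be correct
  -- for elements of `l` and values satisfying `P`.
  have hP : ∀ l₁ l₂ : List α, l = l₁ ++ l₂ → P (l₁.foldl step b) := by
    intro l₁
    induction l₁ using List.reverseRecOn with
    | nil => exact fun _ _ => hb
    | append_singleton l₁ a ih =>
      intro l₂ h
      rw [List.foldl_append]
      exact (hbody _ a (by simp [h]) (ih (a :: l₂) (by simp [h]))).1
  refine fold_prefix f (fun l₁ => g (l₁.foldl step b)) hlist hlen hinit fun l₁ a l₂ h => ?_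
  rw [List.foldl_append]
  exact (hbody _ a (by simp [h]) (hP l₁ _ h)).2

theorem fold {α β : Type*} {len : Polynomial ℕ} {list init body : Code} {env : Data}
    (f : α → Data) (g : β → Data) (step : β → α → β) {l : List α} {b : β}
    (hlist : Comp O s list env (.ofList (l.map f))) (hlen : l.length ≤ len.eval s)
    (hinit : Comp O s init env (g b))
    (hbody : ∀ b, ∀ a ∈ l, Comp O s body (.pair (f a) (.pair (g b) env)) (g (step b a))) :
    Comp O s (.fold len list init body) env (g (l.foldl step b)) :=
  fold_inv f g step (fun _ => True) hlist hlen hinit trivial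
    fun b a ha _ => ⟨trivial, hbody b a ha⟩

end Comp

/-! ### Accumulating lists -/

/-- Order and repetitions in the accumulated lists are irrelevant for the correctness of the
sampling; membership and length are all that is used. -/
theorem mem_foldl_iff {α β : Type*} {step : List β → α → List β} {R : α → β → Prop}
    (h : ∀ acc a y, y ∈ step acc a ↔ y ∈ acc ∨ R a y) (l : List α) (acc : List β) (y : β) :
    y ∈ l.foldl step acc ↔ y ∈ acc ∨ ∃ a ∈ l, R a y := by
  induction l generalizing acc with
  | nil => simp
  | cons a l ih => simp [ih, h, or_assoc]

theorem length_foldl {α β : Type*} {step : List β → α → List β} {c : ℕ}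
    (h : ∀ acc a, (step acc a).length = acc.length + c) (l : List α) (acc : List β) :
    (l.foldl step acc).length = acc.length + l.length * c := by
  induction l generalizing acc with
  | nil => simp
  | cons a l ih => simp [ih, h]; ring

theorem foldl_cons_map {α β : Type*} (f : α → β) (l : List α) (acc : List β) :
    l.foldl (fun acc a => f a :: acc) acc = (l.map f).reverse ++ acc := by
  induction l generalizing acc with
  | nil => simp
  | cons a l ih => simp [ih]

theorem foldl_const {α β : Type*} (f : β → β) (l : List α) (b : β) :
    l.foldl (fun b _ => f b) b = f^[l.length] b := by
  induction l generalizing b with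
  | nil => rfl
  | cons a l ih => simp [ih]

/-! ### Realizing the sign vectors of affine functions -/

/-- Affine functions of `d` variables, given by their coefficients. -/
inductive Aff : ℕ → Type
  | const (c : ℝ) : Aff 0
  | cons {d : ℕ} (b : ℝ) (l : Aff d) : Aff (d + 1)

/-- Points of `d`-dimensional space. -/
inductive Pt : ℕ → Type
  | nil : Pt 0
  | cons {d : ℕ} (z : ℝ) (x : Pt d) : Pt (d + 1)

/-- The coefficient of the first variable. -/
def Aff.coeff {d : ℕ} : Aff (d + 1) → ℝ
  | .cons b _ => b

/-- The remaining part, which does not involve the first variable. -/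
def Aff.rest {d : ℕ} : Aff (d + 1) → Aff d
  | .cons _ l => l

/-- The value of an affine function. -/
noncomputable def Aff.eval : ∀ {d : ℕ}, Aff d → Pt d → ℝ
  | _, .const c, _ => c
  | _, .cons b l, .cons z x => b * z + l.eval x

/-- The difference `r * k - s * l`. -/
noncomputable def Aff.combine (r s : ℝ) : ∀ {d : ℕ}, Aff d → Aff d → Aff d
  | _, .const c, .const c' => .const (r * c - s * c')
  | _, .cons b k, .cons b' l => .cons (r * b - s * b') (k.combine r s l)

/-- The zero function. -/
noncomputable def Aff.zero : ∀ d : ℕ, Aff d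
  | 0 => .const 0
  | d + 1 => .cons 0 (Aff.zero d)

theorem Aff.eval_combine (r s : ℝ) : ∀ {d : ℕ} (k l : Aff d) (x : Pt d),
    (Aff.combine r s k l).eval x = r * k.eval x - s * l.eval x
  | _, .const _, .const _, _ => by simp [Aff.eval, Aff.combine]
  | _, .cons _ k, .cons _ l, .cons _ x => by
    simp only [Aff.eval, Aff.combine, Aff.eval_combine r s k l x]
    ring

/-- The elimination of the first variable from two affine functions. -/
noncomputable def Aff.elim {d : ℕ} (k l : Aff (d + 1)) : Aff d :=
  Aff.combine l.coeff k.coeff k.rest l.rest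

/-- The affine function that is the first variable. -/
noncomputable def Aff.first (d : ℕ) : Aff (d + 1) := .cons 1 (Aff.zero d)

/-- The zero of an affine function as a function of the first variable. -/
noncomputable def Aff.root {d : ℕ} (x : Pt d) (k : Aff (d + 1)) : ℝ :=
  (0 - k.rest.eval x) / k.coeff

/-- The eliminations of the first variable from all pairs in a list. -/
noncomputable def Aff.elims {d : ℕ} (L : List (Aff (d + 1))) : List (Aff d) :=
  L.foldl (fun acc k => L.foldl (fun acc l => Aff.elim k l :: acc) acc) []

/-- The roots of all affine functions in a list. -/
noncomputable def Aff.roots {d : ℕ} (x : Pt d) (L : List (Aff (d + 1))) : List ℝ :=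
  L.foldl (fun acc k => Aff.root x k :: acc) []

/-- The points over `x` whose first coordinate is, up to a shift by at most one, the mean of two of
the given numbers. -/
noncomputable def Pt.lifts {d : ℕ} (x : Pt d) (R : List ℝ) (acc : List (Pt (d + 1))) :
    List (Pt (d + 1)) :=
  R.foldl (fun acc r => R.foldl (fun acc r' =>
    Pt.cons ((r + r') / 2) x :: Pt.cons ((r + r') / 2 + 1) x :: Pt.cons ((r + r') / 2 - 1) x :: acc) acc) acc

/-- Points that realize all sign vectors of a list of affine functions. -/
noncomputable def samples : ∀ d : ℕ, List (Aff d) → List (Pt d)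
  | 0, _ => [.nil]
  | d + 1, L =>
    -- Adding the first variable to the list guarantees a root, and eliminating against it retains
    -- the functions that do not involve the first variable.
    (samples d (Aff.elims (Aff.first d :: L))).foldl
      (fun acc x => Pt.lifts x (Aff.roots x (Aff.first d :: L)) acc) []

theorem Aff.mem_elims {d : ℕ} {L : List (Aff (d + 1))} {e : Aff d} :
    e ∈ Aff.elims L ↔ ∃ k ∈ L, ∃ l ∈ L, e = Aff.elim k l := by
  unfold Aff.elims
  rw [mem_foldl_iff (R := fun k e => ∃ l ∈ L, e = Aff.elim k l)]
  · simp
  · intro acc k y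
    rw [mem_foldl_iff (R := fun l e => e = Aff.elim k l)]
    intro acc a y
    simp [or_comm]

theorem Aff.length_elims {d : ℕ} (L : List (Aff (d + 1))) :
    (Aff.elims L).length = L.length * L.length := by
  unfold Aff.elims
  rw [length_foldl (c := L.length)]
  · simp
  · intro acc k
    rw [length_foldl (c := 1)]
    · simp
    · simp

theorem Aff.mem_roots {d : ℕ} {x : Pt d} {L : List (Aff (d + 1))} {r : ℝ} :
    r ∈ Aff.roots x L ↔ ∃ k ∈ L, r = Aff.root x k := by
  unfold Aff.roots
  rw [mem_foldl_iff (R := fun k r => r = Aff.root x k)]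
  · simp
  · simp [or_comm]

theorem Aff.length_roots {d : ℕ} (x : Pt d) (L : List (Aff (d + 1))) :
    (Aff.roots x L).length = L.length := by
  unfold Aff.roots
  rw [length_foldl (c := 1)] <;> simp

theorem Pt.mem_lifts {d : ℕ} {x : Pt d} {R : List ℝ} {acc : List (Pt (d + 1))} {y : Pt (d + 1)} :
    y ∈ Pt.lifts x R acc ↔ y ∈ acc ∨ ∃ r ∈ R, ∃ r' ∈ R,
      (y = Pt.cons ((r + r') / 2) x ∨ y = Pt.cons ((r + r') / 2 + 1) x ∨ y = Pt.cons ((r + r') / 2 - 1) x) := by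
  unfold Pt.lifts
  rw [mem_foldl_iff (R := fun r y => ∃ r' ∈ R,
      (y = Pt.cons ((r + r') / 2) x ∨ y = Pt.cons ((r + r') / 2 + 1) x ∨ y = Pt.cons ((r + r') / 2 - 1) x))]
  intro acc r y
  rw [mem_foldl_iff (R := fun r' y =>
      (y = Pt.cons ((r + r') / 2) x ∨ y = Pt.cons ((r + r') / 2 + 1) x ∨ y = Pt.cons ((r + r') / 2 - 1) x))]
  intro acc r y
  simp only [List.mem_cons]
  tauto

theorem Pt.length_lifts {d : ℕ} (x : Pt d) (R : List ℝ) (acc : List (Pt (d + 1))) :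
    (Pt.lifts x R acc).length = acc.length + R.length * (R.length * 3) := by
  unfold Pt.lifts
  rw [length_foldl]
  intro acc r
  rw [length_foldl]
  simp

theorem length_samples_succ (d : ℕ) (L : List (Aff (d + 1))) :
    (samples (d + 1) L).length = (samples d (Aff.elims (Aff.first d :: L))).length *
      ((L.length + 1) * ((L.length + 1) * 3)) := by
  rw [samples, length_foldl (c := (L.length + 1) * ((L.length + 1) * 3))]
  · simp
  · intro acc x
    rw [Pt.length_lifts, Aff.length_roots]
    simp

/-- The position of `z` among the points `r k` is the position of some mean of two points `s k`, up
to a shift, among the points `s k`, if both families are ordered in the same way. -/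
theorem exists_same_position {ι : Type*} {K : Set ι} (hK : K.Finite) (hne : K.Nonempty)
    {r s : ι → ℝ} (h : ∀ k ∈ K, ∀ l ∈ K, SignType.sign (s k - s l) = SignType.sign (r k - r l))
    (z : ℝ) : ∃ k ∈ K, ∃ l ∈ K, ∃ c : ℝ, (c = 0 ∨ c = 1 ∨ c = -1) ∧ ∀ j ∈ K,
      SignType.sign ((s k + s l) / 2 + c - s j) = SignType.sign (z - r j) := by
  have hle : ∀ k ∈ K, ∀ l ∈ K, r k ≤ r l → s k ≤ s l := by
    intro k hk l hl hkl
    have h1 := h k hk l hl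
    by_contra hlt
    push Not at hlt
    rw [sign_pos (by linarith), eq_comm, sign_eq_one_iff] at h1
    linarith
  have hlt : ∀ k ∈ K, ∀ l ∈ K, r k < r l → s k < s l := by
    intro k hk l hl hkl
    have h1 := h k hk l hl
    rw [sign_neg (show r k - r l < 0 by linarith), sign_eq_neg_one_iff] at h1
    linarith
  by_cases hz : ∃ k ∈ K, r k = z
  · obtain ⟨k, hk, rfl⟩ := hz
    refine ⟨k, hk, k, hk, 0, by simp, fun j hj => ?_⟩
    rw [← h k hk j hj]
    congr 1
    ring
  -- From here `z` differs from every `r k`, so its position is determined by which points lie below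
  -- it and which above.
  push Not at hz
  have key : ∀ x : ℝ, (∀ j ∈ K, r j < z → s j < x) → (∀ j ∈ K, z < r j → x < s j) →
      ∀ j ∈ K, SignType.sign (x - s j) = SignType.sign (z - r j) := by
    intro x h1 h2 j hj
    rcases lt_or_gt_of_ne (hz j hj) with hj' | hj'
    · rw [sign_pos (by linarith [h1 j hj hj']), sign_pos (by linarith)]
    · rw [sign_neg (by linarith [h2 j hj hj']), sign_neg (by linarith)]
  have hfin₁ : {k ∈ K | r k < z}.Finite := hK.subset fun k hk => hk.1
  have hfin₂ : {k ∈ K | z < r k}.Finite := hK.subset fun k hk => hk.1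
  rcases {k ∈ K | r k < z}.eq_empty_or_nonempty with h1 | h1 <;>
    rcases {k ∈ K | z < r k}.eq_empty_or_nonempty with h2 | h2
  · obtain ⟨k, hk⟩ := hne
    rcases lt_or_gt_of_ne (hz k hk) with hj' | hj'
    · exact absurd (show k ∈ {k ∈ K | r k < z} from ⟨hk, hj'⟩) (by simp [h1])
    · exact absurd (show k ∈ {k ∈ K | z < r k} from ⟨hk, hj'⟩) (by simp [h2])
  -- All points lie above `z`: the smallest of the points `s k`, shifted down by 1, has the same
  -- position. The next case is symmetric.
  · obtain ⟨l, ⟨hl, hlz⟩, hmin⟩ := Set.exists_min_image _ r hfin₂ h2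
    refine ⟨l, hl, l, hl, -1, by simp, key _ (fun j hj hjz => ?_) fun j hj hjz => ?_⟩
    · exact absurd (show j ∈ {k ∈ K | r k < z} from ⟨hj, hjz⟩) (by simp [h1])
    · linarith [hle l hl j hj (hmin j ⟨hj, hjz⟩)]
  · obtain ⟨k, ⟨hk, hkz⟩, hmax⟩ := Set.exists_max_image _ r hfin₁ h1
    refine ⟨k, hk, k, hk, 1, by simp, key _ (fun j hj hjz => ?_) fun j hj hjz => ?_⟩
    · linarith [hle j hj k hk (hmax j ⟨hj, hjz⟩)]
    · exact absurd (show j ∈ {k ∈ K | z < r k} from ⟨hj, hjz⟩) (by simp [h2])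
  · obtain ⟨k, ⟨hk, hkz⟩, hmax⟩ := Set.exists_max_image _ r hfin₁ h1
    obtain ⟨l, ⟨hl, hlz⟩, hmin⟩ := Set.exists_min_image _ r hfin₂ h2
    -- `z` lies strictly between its two neighbours `r k < r l`, and the mean of `s k` and `s l`
    -- lies strictly between those.
    have hkl := hlt k hk l hl (hkz.trans hlz)
    refine ⟨k, hk, l, hl, 0, by simp, key _ (fun j hj hjz => ?_) fun j hj hjz => ?_⟩
    · linarith [hle j hj k hk (hmax j ⟨hj, hjz⟩)]
    · linarith [hle l hl j hj (hmin j ⟨hj, hjz⟩)]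

/-- Induction on the dimension by elimination. If the sample `x` gives all eliminations the same
signs as `y`, then the roots in the first variable are ordered over `x` as over `y`, and the first
coordinate `z` can be replaced by a shifted mean of two roots in the same position. -/
theorem exists_mem_samples : ∀ (d : ℕ) (L : List (Aff d)) (y : Pt d),
    ∃ x ∈ samples d L, ∀ l ∈ L, SignType.sign (l.eval x) = SignType.sign (l.eval y)
  | 0, L, y => ⟨.nil, by simp [samples], fun _ _ => by cases y; rfl⟩
  | d + 1, L, .cons z y => by
    obtain ⟨x, hx, hsign⟩ := exists_mem_samples d (Aff.elims (Aff.first d :: L)) y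
    set L' := Aff.first d :: L with hL'
    have helim : ∀ k ∈ L', ∀ l ∈ L', SignType.sign ((Aff.elim k l).eval x)
        = SignType.sign ((Aff.elim k l).eval y) := fun k hk l hl =>
      hsign _ (Aff.mem_elims.2 ⟨k, hk, l, hl, rfl⟩)
    -- The sign of the difference of two roots is that of the elimination, up to a factor that does
    -- not depend on the point.
    have hsub : ∀ (k l : Aff (d + 1)) (p : Pt d), k.coeff ≠ 0 → l.coeff ≠ 0 →
        Aff.root p k - Aff.root p l = (-1 / (k.coeff * l.coeff)) * (Aff.elim k l).eval p := by
      intro k l p hk hl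
      rw [Aff.elim, Aff.eval_combine, Aff.root, Aff.root]
      field_simp
      ring
    have hfirst : Aff.first d ∈ L' := by simp [hL']
    obtain ⟨k, ⟨hk, -⟩, l, ⟨hl, -⟩, c, hc, hj⟩ :=
      exists_same_position (K := {k : Aff (d + 1) | k ∈ L' ∧ k.coeff ≠ 0})
        (L'.finite_toSet.subset fun k hk => hk.1) ⟨Aff.first d, hfirst, one_ne_zero⟩
        (r := Aff.root y) (s := Aff.root x) (fun k hk l hl => by
          rw [hsub k l x hk.2 hl.2, hsub k l y hk.2 hl.2, sign_mul, sign_mul,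
            helim k hk.1 l hl.1]) z
    refine ⟨Pt.cons ((Aff.root x k + Aff.root x l) / 2 + c) x, ?_, fun j hjL => ?_⟩
    · rw [samples, mem_foldl_iff (R := fun x' y' => ∃ r ∈ Aff.roots x' L', ∃ r' ∈ Aff.roots x' L',
        (y' = Pt.cons ((r + r') / 2) x' ∨ y' = Pt.cons ((r + r') / 2 + 1) x' ∨ y' = Pt.cons ((r + r') / 2 - 1) x'))
        (fun acc a y => Pt.mem_lifts)]
      refine Or.inr ⟨x, hx, _, Aff.mem_roots.2 ⟨k, hk, rfl⟩, _, Aff.mem_roots.2 ⟨l, hl, rfl⟩, ?_⟩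
      rcases hc with rfl | rfl | rfl
      · simp
      · simp
      · simp [sub_eq_add_neg]
    · have hjL' : j ∈ L' := by simp [hL', hjL]
      by_cases hj0 : j.coeff = 0
      -- For a function without the first variable, eliminating against `Aff.first d` gives back its
      -- remaining part.
      · have := helim j hjL' _ hfirst
        simp only [Aff.elim, Aff.eval_combine, Aff.first, Aff.coeff, one_mul] at this
        obtain ⟨b, j⟩ := j
        simp only [Aff.coeff] at hj0
        simpa [Aff.eval, Aff.rest, hj0] using this
      · have hroot : ∀ (t : ℝ) (p : Pt d),
            j.eval (.cons t p) = j.coeff * (t - Aff.root p j) := by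
          intro t p
          obtain ⟨b, j⟩ := j
          simp only [Aff.coeff] at hj0
          simp only [Aff.root, Aff.eval, Aff.coeff, Aff.rest]
          field_simp
          ring
        rw [hroot, hroot, sign_mul, sign_mul, hj j ⟨hjL', hj0⟩]

/-! ### Kinetic sorting -/

/-- A list with two distinguished neighbours, which are to be swapped. The part before them is
stored in reverse order. -/
structure Swap (α : Type*) where
  pre : List α
  fst : α
  snd : α
  post : List α

namespace Swap

variable {α : Type*}

/-- The list before the swap. -/
def before (σ : Swap α) : List α := σ.pre.reverse ++ σ.fst :: σ.snd :: σ.post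

/-- The list after the swap. -/
def after (σ : Swap α) : List α := σ.pre.reverse ++ σ.snd :: σ.fst :: σ.post

theorem after_perm (σ : Swap α) : σ.after.Perm σ.before :=
  List.Perm.append_left _ (List.Perm.swap _ _ _)

/-- The number `τ` for which `x + τ * y` has the same value at both elements. -/
noncomputable def time (x y : α → ℝ) (σ : Swap α) : ℝ :=
  (x σ.fst - x σ.snd) / (y σ.snd - y σ.fst)

end Swap

section Kinetic

variable {α : Type*} (x y : α → ℝ)

open Classical in
/-- Replace the best swap found so far by the given one if that increases `y` in front and comes
earlier. -/
noncomputable def improve (best : Option (Swap α)) (σ : Swap α) : Option (Swap α) :=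
  if y σ.fst < y σ.snd then
    match best with
    | none => some σ
    | some ρ => if σ.time x y < ρ.time x y then some σ else some ρ
  else best

/-- Move on by one position in the search for the earliest swap. -/
noncomputable def scanStep :
    List α × List α × Option (Swap α) → List α × List α × Option (Swap α)
  | (p, u :: v :: s, best) => (u :: p, v :: s, improve x y best ⟨p, u, v, s⟩)
  | st => st

/-- The earliest swap of neighbours that increases `y` in front. -/
noncomputable def scan (l : List α) : Option (Swap α) :=
  (l.foldl (fun st _ => scanStep x y st) ([], l, none)).2.2

/-- Perform the earliest swap, if there is any. -/
noncomputable def swapStep (l : List α) : List α :=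
  match scan x y l with
  | none => l
  | some σ => σ.after

/-- Perform the earliest swap, if there is any, and record it. -/
noncomputable def chainStep (c : List α × List (Swap α)) : List α × List (Swap α) :=
  match scan x y c.1 with
  | none => c
  | some σ => (σ.after, σ :: c.2)

/-- The property of the search for the earliest swap in `l`, at the split of `l` into `p.reverse`
and `r`. -/
def ScanInv (l : List α) : List α × List α × Option (Swap α) → Prop
  | (p, r, best) => p.reverse ++ r = l ∧
    match best with
    | none => List.IsChain (fun u v => y v ≤ y u) (p.reverse ++ r.take 1)
    | some σ => σ.before = l ∧ y σ.fst < y σ.snd ∧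
        List.IsChain (fun u v => y u < y v → σ.time x y ≤ (x u - x v) / (y v - y u))
          (p.reverse ++ r.take 1)

theorem isChain_snoc {R : α → α → Prop} {p : List α} {u v : α}
    (h : List.IsChain R (p.reverse ++ [u])) (huv : R u v) :
    List.IsChain R ((u :: p).reverse ++ [v]) := by
  rw [List.reverse_cons]
  refine List.isChain_append.2 ⟨h, by simp, ?_⟩
  simpa using huv

variable {x y}

theorem ScanInv.step {l : List α} {st : List α × List α × Option (Swap α)}
    (h : ScanInv x y l st) : ScanInv x y l (scanStep x y st) := by
  rcases st with ⟨p, _ | ⟨u, _ | ⟨v, s⟩⟩, best⟩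
  · exact h
  · exact h
  obtain ⟨hl, hb⟩ := h
  refine ⟨by simpa using hl, ?_⟩
  simp only [List.take_succ_cons, List.take_zero] at hb ⊢
  unfold improve
  dsimp only
  rcases best with _ | ρ
  · by_cases huv : y u < y v
    · rw [if_pos huv]
      refine ⟨hl, huv, isChain_snoc (hb.imp fun _ _ hle hlt => absurd hlt hle.not_gt) fun _ => le_rfl⟩
    · rw [if_neg huv]
      exact isChain_snoc hb (not_lt.1 huv)
  · obtain ⟨hρl, hρ, hb⟩ := hb
    by_cases huv : y u < y v
    · rw [if_pos huv]
      by_cases ht : Swap.time x y ⟨p, u, v, s⟩ < ρ.time x y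
      · simp only [ht, if_true]
        exact ⟨hl, huv, isChain_snoc (hb.imp fun _ _ h1 h2 => ht.le.trans (h1 h2)) fun _ => le_rfl⟩
      · simp only [ht, if_false]
        exact ⟨hρl, hρ, isChain_snoc hb fun _ => not_lt.1 ht⟩
    · rw [if_neg huv]
      exact ⟨hρl, hρ, isChain_snoc hb fun h => absurd h huv⟩

theorem length_scanStep (st : List α × List α × Option (Swap α)) :
    (scanStep x y st).2.1.length - 1 = st.2.1.length - 1 - 1 := by
  rcases st with ⟨p, _ | ⟨u, _ | ⟨v, s⟩⟩, best⟩ <;> simp [scanStep]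

/-- The list `l'` only counts the steps. Truncated subtraction expresses that the search idles once
at most one element remains. -/
theorem scanInv_foldl (l l' : List α) (st : List α × List α × Option (Swap α))
    (h : ScanInv x y l st) :
    ScanInv x y l (l'.foldl (fun st _ => scanStep x y st) st) ∧
      (l'.foldl (fun st _ => scanStep x y st) st).2.1.length - 1
        = st.2.1.length - 1 - l'.length := by
  induction l' generalizing st with
  | nil => exact ⟨h, by simp⟩
  | cons a l' ih =>
    obtain ⟨h1, h2⟩ := ih _ h.step
    refine ⟨h1, ?_⟩
    rw [List.foldl_cons, h2, length_scanStep, List.length_cons]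
    omega

theorem scan_spec (l : List α) :
    match scan x y l with
    | none => List.IsChain (fun u v => y v ≤ y u) l
    | some σ => σ.before = l ∧ y σ.fst < y σ.snd ∧
        List.IsChain (fun u v => y u < y v → σ.time x y ≤ (x u - x v) / (y v - y u)) l := by
  obtain ⟨h, hlen⟩ := scanInv_foldl (x := x) (y := y) l l ([], l, none)
    ⟨rfl, by rcases l with _ | ⟨a, l⟩ <;> simp⟩
  unfold scan
  generalize l.foldl (fun st _ => scanStep x y st) ([], l, none) = st at h hlen
  obtain ⟨p, r, best⟩ := st
  have hr : r.take 1 = r := List.take_of_length_le (by simp only at hlen; omega)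
  obtain ⟨hl, hb⟩ := h
  rw [hr, hl] at hb
  exact hb

/-! ### Inversions, which bound the number of swaps -/

open Classical in
/-- The number of pairs of positions at which `y` is larger at the later position. -/
noncomputable def inversions (y : α → ℝ) : List α → ℕ
  | [] => 0
  | u :: l => l.countP (fun v => y u < y v) + inversions y l

theorem inversions_le (l : List α) : inversions y l ≤ l.length * l.length := by
  induction l with
  | nil => simp [inversions]
  | cons u l ih =>
    classical
    have := List.countP_le_length (p := fun v => decide (y u < y v)) (l := l)
    simp only [inversions, List.length_cons]
    nlinarith

theorem Swap.inversions_after (σ : Swap α) (h : y σ.fst < y σ.snd) :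
    inversions y σ.after + 1 = inversions y σ.before := by
  obtain ⟨p, u, v, s⟩ := σ
  simp only [Swap.after, Swap.before] at h ⊢
  generalize p.reverse = q
  induction q with
  | nil =>
    simp only [List.nil_append, inversions, List.countP_cons, h, h.not_gt, decide_true, decide_false,
      if_true, Bool.false_eq_true, if_false]
    omega
  | cons a q ih =>
    simp only [List.cons_append, inversions]
    -- An element in front of the swap contributes equally before and after, since its count ignores
    -- the order of what follows.
    rw [((List.Perm.swap u v s).append_left q).countP_eq]
    omega

/-- If every step changes nothing or lowers a measure, then enough steps lead to a state that is not
changed. -/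
theorem fixed_of_iterate {β : Type*} {f : β → β} {μ : β → ℕ}
    (h : ∀ b, f b = b ∨ μ (f b) < μ b) : ∀ (k : ℕ) (b : β), μ b ≤ k → f (f^[k] b) = f^[k] b
  | 0, b, hb => by
    rcases h b with hf | hf
    · exact hf
    · simp only [Function.iterate_zero, id]
      omega
  | k + 1, b, hb => by
    rw [Function.iterate_succ_apply]
    rcases h b with hf | hf
    · rw [hf]
      have : ∀ j, f^[j] b = b := fun j => Function.iterate_fixed hf j
      rw [this, hf]
    · exact fixed_of_iterate h k _ (by omega)

theorem swapStep_cases (l : List α) :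
    (scan x y l = none ∧ swapStep x y l = l) ∨
      inversions y (swapStep x y l) < inversions y l := by
  have h := scan_spec (x := x) (y := y) l
  unfold swapStep
  rcases hs : scan x y l with _ | σ
  · simp
  · right
    rw [hs] at h
    obtain ⟨rfl, h, -⟩ := h
    have := σ.inversions_after h
    dsimp only
    omega

theorem swapStep_perm (l : List α) : (swapStep x y l).Perm l := by
  have h := scan_spec (x := x) (y := y) l
  unfold swapStep
  rcases hs : scan x y l with _ | σ
  · exact .refl _
  · rw [hs] at h
    obtain ⟨rfl, -⟩ := h
    exact σ.after_perm

theorem iterate_swapStep_perm (k : ℕ) (l : List α) : ((swapStep x y)^[k] l).Perm l := by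
  induction k generalizing l with
  | zero => exact .refl _
  | succ k ih => exact (ih _).trans (swapStep_perm l)

theorem isChain_iterate_swapStep {k : ℕ} {l : List α} (hk : l.length * l.length ≤ k) :
    List.IsChain (fun u v => y v ≤ y u) ((swapStep x y)^[k] l) := by
  have hfix := fixed_of_iterate (f := swapStep x y) (μ := inversions y)
    (fun b => (swapStep_cases b).imp_left And.right) k l ((inversions_le l).trans hk)
  have h := scan_spec (x := x) (y := y) ((swapStep x y)^[k] l)
  rcases swapStep_cases (x := x) (y := y) ((swapStep x y)^[k] l) with h' | h'
  · rw [h'.1] at h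
    exact h
  · rw [hfix] at h'
    exact absurd h' (lt_irrefl _)

/-! ### Chains of swaps in the order of time -/

variable (x y)

/-- The list is sorted by `x + τ * y` in descending order. -/
def SortedAt (τ : ℝ) (l : List α) : Prop := l.Pairwise fun u v => x v + τ * y v ≤ x u + τ * y u

/-- A sequence of swaps, the last one first, that leads to the list `l`, with lists that are sorted
at the times of their swaps. -/
inductive Chain : List α → List (Swap α) → Prop where
  | start {l : List α} : SortedAt x y 0 l → Chain l []
  | step {σ : Swap α} {c : List (Swap α)} : Chain σ.before c → y σ.fst < y σ.snd →
      SortedAt x y (σ.time x y) σ.before → Chain σ.after (σ :: c)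

/-- The time of the last swap. -/
noncomputable def lastTime : List (Swap α) → ℝ
  | [] => 0
  | σ :: _ => σ.time x y

variable {x y}

theorem Swap.time_spec {σ : Swap α} (h : y σ.fst < y σ.snd) :
    x σ.fst + σ.time x y * y σ.fst = x σ.snd + σ.time x y * y σ.snd := by
  have : y σ.snd - y σ.fst ≠ 0 := by linarith
  unfold Swap.time
  field_simp
  ring

/-- At the time of the swap the two swapped elements have equal values, so the sequence of values is
unchanged. -/
theorem Swap.sortedAt_after {σ : Swap α} (h : y σ.fst < y σ.snd)
    (hs : SortedAt x y (σ.time x y) σ.before) : SortedAt x y (σ.time x y) σ.after := by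
  have ht := Swap.time_spec (x := x) h
  have hs' : (σ.before.map fun u => x u + σ.time x y * y u).Pairwise (· ≥ ·) :=
    List.pairwise_map.2 hs
  refine List.pairwise_map (f := fun u => x u + σ.time x y * y u) (R := (· ≥ ·)).1 ?_
  convert hs' using 1
  simp [Swap.after, Swap.before, ht]

theorem Chain.sortedAt_lastTime {l : List α} {c : List (Swap α)} (h : Chain x y l c) :
    SortedAt x y (lastTime x y c) l := by
  cases h with
  | start h => exact h
  | step _ h hs => exact Swap.sortedAt_after h hs

/-- The comparison of two elements is affine in the time, so it holds between two times at which it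
holds. -/
theorem SortedAt.between {τ₁ τ₂ τ : ℝ} {l : List α} (h₁ : SortedAt x y τ₁ l)
    (h₂ : SortedAt x y τ₂ l) (h1 : τ₁ ≤ τ) (h2 : τ ≤ τ₂) : SortedAt x y τ l := by
  refine (h₁.and h₂).imp fun {u v} ⟨hu, hv⟩ => ?_
  rcases le_total (y v) (y u) with h | h <;> nlinarith

theorem SortedAt.of_antitone {τ₁ τ : ℝ} {l : List α} (h₁ : SortedAt x y τ₁ l)
    (hy : l.Pairwise fun u v => y v ≤ y u) (h1 : τ₁ ≤ τ) : SortedAt x y τ l := by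
  refine (h₁.and hy).imp fun {u v} ⟨hu, hv⟩ => ?_
  nlinarith

theorem sortedAt_of_isChain {τ : ℝ} {l : List α}
    (h : List.IsChain (fun u v => x v + τ * y v ≤ x u + τ * y u) l) : SortedAt x y τ l := by
  have : IsTrans α (fun u v => x v + τ * y v ≤ x u + τ * y u) :=
    ⟨fun _ _ _ h1 h2 => le_trans h2 h1⟩
  exact List.isChain_iff_pairwise.1 h

/-- Taking the earliest crossing of neighbours keeps the list sorted up to that crossing, and the
crossing cannot precede the last swap, because the list was sorted then. -/
theorem Chain.chainStep {c : List α × List (Swap α)} (h : Chain x y c.1 c.2) :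
    Chain x y (chainStep x y c).1 (chainStep x y c).2 := by
  have hs := scan_spec (x := x) (y := y) c.1
  obtain ⟨l, c⟩ := c
  unfold MultiRank.chainStep
  rcases hσ : scan x y l with _ | σ
  · simpa [hσ] using h
  · simp only [hσ] at hs ⊢
    obtain ⟨rfl, hlt, hmin⟩ := hs
    refine .step h hlt (sortedAt_of_isChain ?_)
    have hlast := h.sortedAt_lastTime
    have hle : lastTime x y c ≤ σ.time x y := by
      have h1 : x σ.snd + lastTime x y c * y σ.snd ≤ x σ.fst + lastTime x y c * y σ.fst := by
        have h2 := (List.pairwise_append.1 hlast).2.1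
        exact (List.pairwise_cons.1 h2).1 _ (by simp)
      unfold Swap.time
      rw [le_div_iff₀ (by linarith)]
      linarith
    have hlast' : List.IsChain _ σ.before := List.Pairwise.isChain hlast
    -- Neighbours with increasing `y` have not crossed yet by minimality of the time; for the others
    -- the order at the last swap persists.
    refine List.isChain_iff_getElem.2 fun i hi => ?_
    have h1 := List.isChain_iff_getElem.1 hlast' i hi
    have h2 := List.isChain_iff_getElem.1 hmin i hi
    rcases lt_or_ge (y σ.before[i]) (y σ.before[i + 1]) with hy | hy
    · have := h2 hy
      rw [le_div_iff₀ (by linarith)] at this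
      linarith
    · nlinarith

theorem chainStep_cases (c : List α × List (Swap α)) :
    (scan x y c.1 = none ∧ chainStep x y c = c) ∨
      inversions y (chainStep x y c).1 < inversions y c.1 := by
  have h := scan_spec (x := x) (y := y) c.1
  unfold chainStep
  rcases hs : scan x y c.1 with _ | σ
  · simp
  · right
    rw [hs] at h
    obtain ⟨h1, h, -⟩ := h
    have := σ.inversions_after h
    rw [h1] at this
    dsimp only
    omega

theorem iterate_chainStep {k : ℕ} {l : List α} (hl : SortedAt x y 0 l)
    (hk : l.length * l.length ≤ k) :
    Chain x y ((chainStep x y)^[k] (l, [])).1 ((chainStep x y)^[k] (l, [])).2 ∧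
      ((chainStep x y)^[k] (l, [])).1.Pairwise fun u v => y v ≤ y u := by
  constructor
  · have : ∀ (j : ℕ) (c : List α × List (Swap α)), Chain x y c.1 c.2 →
        Chain x y ((chainStep x y)^[j] c).1 ((chainStep x y)^[j] c).2 := by
      intro j
      induction j with
      | zero => exact fun _ h => h
      | succ j ih => exact fun c h => ih _ h.chainStep
    exact this k _ (.start hl)
  · have hfix := fixed_of_iterate (f := chainStep x y) (μ := fun c => inversions y c.1)
      (fun b => (chainStep_cases b).imp_left And.right) k (l, []) ((inversions_le l).trans hk)
    set c := (chainStep x y)^[k] (l, []) with hc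
    have h := scan_spec (x := x) (y := y) c.1
    rcases chainStep_cases (x := x) (y := y) c with h' | h'
    · rw [h'.1] at h
      have : IsTrans α (fun u v => y v ≤ y u) := ⟨fun _ _ _ h1 h2 => le_trans h2 h1⟩
      exact List.isChain_iff_pairwise.1 h
    · rw [hfix] at h'
      exact absurd h' (lt_irrefl _)

theorem length_iterate_chainStep (k : ℕ) (c : List α × List (Swap α)) :
    ((chainStep x y)^[k] c).2.length ≤ c.2.length + k := by
  induction k generalizing c with
  | zero => simp
  | succ k ih =>
    refine (ih _).trans ?_
    unfold chainStep
    split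
    · simp
    · simp only [List.length_cons]
      omega

theorem Chain.perm {l l₀ : List α} {c : List (Swap α)} (h : Chain x y l c) (hl : l.Perm l₀) :
    ∀ σ ∈ c, σ.before.Perm l₀ := by
  induction h with
  | start => simp
  | @step σ c _ _ _ ih =>
    have := σ.after_perm.symm.trans hl
    intro ρ hρ
    rcases List.mem_cons.1 hρ with rfl | hρ
    · exact this
    · exact ih this _ hρ

/-- The earliest swap that fails the test `p`; if there is none, then the default value. The swaps
are listed the last one first. -/
def choose {β : Type*} (p : β → Prop) [DecidablePred p] (σ : β) (c : List β) : β :=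
  c.foldl (fun acc ρ => if p ρ then acc else ρ) σ

theorem choose_of_forall {β : Type*} {p : β → Prop} [DecidablePred p] {σ : β} {c : List β}
    (h : ∀ ρ ∈ c, p ρ) : choose p σ c = σ := by
  unfold choose
  induction c with
  | nil => rfl
  | cons ρ c ih => rw [List.foldl_cons, if_pos (h ρ (by simp)), ih fun ρ hρ => h ρ (by simp [hρ])]

theorem choose_mem {β : Type*} {p : β → Prop} [DecidablePred p] {c : List β} :
    ∀ {σ : β}, choose p σ c ∈ σ :: c := by
  unfold choose
  induction c with
  | nil => simp
  | cons ρ c ih =>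
    intro σ
    rw [List.foldl_cons]
    have := @ih (if p ρ then σ else ρ)
    split_ifs at this ⊢ with h
    · rcases List.mem_cons.1 this with h | h <;> simp [h]
    · exact List.mem_cons_of_mem _ this

/-- The program chooses among stored links, the correctness proof among swaps; this identifies the
two choices. -/
theorem choose_map {β γ : Type*} {p : γ → Prop} [DecidablePred p] (f : β → γ) (σ : β)
    (c : List β) : choose p (f σ) (c.map f) = f (choose (fun ρ => p (f ρ)) σ c) := by
  unfold choose
  induction c generalizing σ with
  | nil => rfl
  | cons ρ c ih =>
    rw [List.map_cons, List.foldl_cons, List.foldl_cons, ← ih]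
    split_ifs <;> rfl

/-- If the directions at the lists are given by `r`, then the chosen list is optimal for its own
direction, or the direction that belongs to the swap is between the directions before and after the
swap. -/
theorem Chain.choose_spec {l : List α} {c : List (Swap α)} (h : Chain x y l c)
    (hl : l.Pairwise fun u v => y v ≤ y u) {r : List α → ℝ} (hr : ∀ l, 0 ≤ r l)
    {p : Swap α → Prop} [DecidablePred p] (hp : ∀ σ ∈ c, (p σ ↔ σ.time x y < r σ.after))
    {σ₀ : Swap α} (hσ₀ : σ₀.before = l) :
    ∃ σ, σ = choose p σ₀ c ∧ (SortedAt x y (r σ.before) σ.before ∨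
      (y σ.fst < y σ.snd ∧ SortedAt x y (σ.time x y) σ.before ∧ σ.time x y ≤ r σ.before ∧
        r σ.after ≤ σ.time x y)) := by
  -- The second alternative is stated for all defaults, since a later failing swap only replaces the
  -- default in the search among the earlier ones.
  have key : ((∀ σ ∈ c, p σ) ∧ lastTime x y c ≤ r l) ∨ ∀ σ₀,
      ∃ σ, σ = choose p σ₀ c ∧ (SortedAt x y (r σ.before) σ.before ∨
      (y σ.fst < y σ.snd ∧ SortedAt x y (σ.time x y) σ.before ∧ σ.time x y ≤ r σ.before ∧
        r σ.after ≤ σ.time x y)) := by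
    clear hl hσ₀
    induction h with
    | start => exact Or.inl ⟨by simp, hr _⟩
    | @step σ c hc hlt hs ih =>
      rcases ih fun σ hσ => hp σ (by simp [hσ]) with ⟨h1, h2⟩ | h
      · by_cases hσ : p σ
        · exact Or.inl ⟨by simpa [hσ] using h1, ((hp σ (by simp)).1 hσ).le⟩
        · refine Or.inr fun σ₀ => ⟨σ, ?_, ?_⟩
          · unfold choose
            rw [List.foldl_cons, if_neg hσ]
            exact (choose_of_forall h1).symm
          · rw [hp σ (by simp), not_lt] at hσ
            -- `σ` is the earliest failing swap. Either `r` crosses the swap time from before to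
            -- after, or `r σ.before` lies between two times at which the list is sorted.
            rcases le_total (σ.time x y) (r σ.before) with h | h
            · exact Or.inr ⟨hlt, hs, h, hσ⟩
            · exact Or.inl (hc.sortedAt_lastTime.between hs h2 h)
      · right
        intro σ₀
        unfold choose
        rw [List.foldl_cons]
        exact h _
  rcases key with ⟨h1, h2⟩ | h1
  · refine ⟨σ₀, (choose_of_forall h1).symm, Or.inl ?_⟩
    -- No swap fails: the final list has `y` in descending order and stays sorted at all times after
    -- the last swap, in particular at `r l`.
    rw [hσ₀]
    exact h.sortedAt_lastTime.of_antitone hl h2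
  · exact h1 σ₀

end Kinetic

/-! ### Scores of rankings -/

section Scores

variable {n : ℕ}

/-- The cumulative score of a ranking that is given as a list. -/
def listScore (w a : Fin n → ℝ) (l : List (Fin n)) : ℝ :=
  (List.zipWith (fun k j => w k * a j) (List.finRange n) l).sum

open Classical in
/-- The difference of the weights at the positions `t` and `t + 1`. -/
noncomputable def gap (w : Fin n → ℝ) (t : ℕ) : ℝ :=
  if h : t + 1 < n then w ⟨t, by omega⟩ - w ⟨t + 1, h⟩ else 0

/-- The cumulative score of the list before the swap, if the second one of the two weights is
replaced with the first one. -/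
noncomputable def raisedScore (w a : Fin n → ℝ) (σ : Swap (Fin n)) : ℝ :=
  listScore w a σ.before + gap w σ.pre.length * a σ.snd

theorem listScore_ofFn (w a : Fin n → ℝ) (π : Fin n → Fin n) :
    listScore w a (List.ofFn π) = ∑ j, w j * a (π j) := by
  unfold listScore
  rw [← List.sum_ofFn]
  congr 1
  refine List.ext_getElem (by simp) fun i h1 h2 => by simp

theorem exists_perm_of_perm {l : List (Fin n)} (h : l.Perm (List.finRange n)) :
    ∃ π : Equiv.Perm (Fin n), l = List.ofFn π := by
  have hlen : l.length = n := by simpa using h.length_eq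
  have hnodup : l.Nodup := h.nodup_iff.2 (List.nodup_finRange n)
  have hinj : Function.Injective fun j : Fin n => l[(j : ℕ)]'(by omega) := by
    intro i j hij
    exact Fin.ext ((hnodup.getElem_inj_iff).1 hij)
  refine ⟨Equiv.ofBijective _ (Finite.injective_iff_bijective.1 hinj), ?_⟩
  refine List.ext_getElem (by simpa using hlen) fun i h1 h2 => by simp

theorem raise_apply (w : Fin n → ℝ) (t : Fin (n - 1)) (j : Fin n) :
    raise w t j = w j + if j = ⟨t + 1, by omega⟩ then gap w t else 0 := by
  have : (t : ℕ) + 1 < n := by omega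
  simp only [raise, gap, this, dif_pos, Pi.add_apply, Pi.smul_apply, smul_eq_mul, Pi.single_apply]
  split_ifs <;> simp

theorem cs_raise (w a : Fin n → ℝ) (t : Fin (n - 1)) (π : Equiv.Perm (Fin n)) :
    cs (raise w t) a π = cs w a π + gap w t * a (π ⟨t + 1, by omega⟩) := by
  simp [cs, raise_apply, add_mul, Finset.sum_add_distrib, ite_mul]

theorem gap_nonneg {w : Fin n → ℝ} (hw : Antitone w) (t : ℕ) : 0 ≤ gap w t := by
  unfold gap
  split_ifs with h
  · exact sub_nonneg.2 (hw (by simp [Fin.le_def]))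
  · exact le_rfl

theorem drop_finRange {n t : ℕ} (h : t < n) :
    (List.finRange n).drop t = ⟨t, h⟩ :: (List.finRange n).drop (t + 1) := by
  rw [List.drop_eq_getElem_cons (by simpa using h)]
  simp

theorem Swap.length_before {α : Type*} (σ : Swap α) :
    σ.before.length = σ.pre.length + σ.post.length + 2 := by
  simp [Swap.before]
  omega

/-- The score change of a swap is the weight gap times the difference of the items. Hence all edges
at a given swap time are orthogonal to the direction `(1, τ)`. -/
theorem listScore_after (w a : Fin n → ℝ) (σ : Swap (Fin n)) (h : σ.before.length = n) :
    listScore w a σ.after =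
      listScore w a σ.before + gap w σ.pre.length * (a σ.snd - a σ.fst) := by
  have ht : σ.pre.length + 1 < n := by
    have := σ.length_before
    omega
  have hsplit : List.finRange n = (List.finRange n).take σ.pre.length ++
      ⟨σ.pre.length, by omega⟩ :: ⟨σ.pre.length + 1, ht⟩ ::
        (List.finRange n).drop (σ.pre.length + 2) := by
    rw [← drop_finRange ht, ← drop_finRange (t := σ.pre.length), List.take_append_drop]
  unfold listScore Swap.before Swap.after gap
  rw [hsplit, dif_pos ht, List.zipWith_append (by simp; omega), List.zipWith_append (by simp; omega)]
  simp only [List.zipWith_cons_cons, List.sum_append, List.sum_cons]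
  ring

theorem Swap.ofFn_getElem_snd (σ : Swap (Fin n)) {π : Fin n → Fin n} (h : σ.before = List.ofFn π)
    (ht : σ.pre.length + 1 < n) : π ⟨σ.pre.length + 1, ht⟩ = σ.snd := by
  have h1 : σ.before[σ.pre.length + 1]? = some σ.snd := by
    unfold Swap.before
    rw [List.getElem?_append_right (by simp)]
    simp
  rw [h] at h1
  simpa [ht] using h1

/-- Links the list calculus to the statement: `σ.snd` occupies the position whose weight is raised,
which explains the extra term of `raisedScore`. -/
theorem Swap.exists_raise {σ : Swap (Fin n)} (h : σ.before.Perm (List.finRange n)) :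
    ∃ (π : Equiv.Perm (Fin n)) (t : Fin (n - 1)), σ.before = List.ofFn π ∧
      ∀ w a : Fin n → ℝ, cs (raise w t) a π = raisedScore w a σ := by
  obtain ⟨π, hπ⟩ := exists_perm_of_perm h
  have hlen : σ.before.length = n := by simpa using h.length_eq
  have ht : σ.pre.length + 1 < n := by
    have := σ.length_before
    omega
  refine ⟨π, ⟨σ.pre.length, by omega⟩, hπ, fun w a => ?_⟩
  rw [cs_raise, σ.ofFn_getElem_snd hπ ht, raisedScore, hπ, listScore_ofFn, cs]

/-- The rearrangement inequality: a ranking that is sorted by `a + τ * b` maximizes the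
corresponding combination of the scores. -/
theorem SortedAt.le_listScore {w a b : Fin n → ℝ} (hw : Antitone w) {τ : ℝ} {l : List (Fin n)}
    (hl : l.Perm (List.finRange n)) (hs : SortedAt a b τ l) (σ : Equiv.Perm (Fin n)) :
    cs w a σ + τ * cs w b σ ≤ listScore w a l + τ * listScore w b l := by
  obtain ⟨π, rfl⟩ := exists_perm_of_perm hl
  have hmono : Monovary w fun j => a (π j) + τ * b (π j) := by
    intro i j hij
    refine hw (le_of_not_gt fun hlt => hij.not_ge ?_)
    exact (List.pairwise_ofFn.1 hs) hlt
  have h1 := hmono.sum_mul_comp_perm_le_sum_mul (σ := σ.trans π.symm)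
  have hcs : ∀ ρ : Fin n → Fin n, (∑ j, w j * a (ρ j)) + τ * (∑ j, w j * b (ρ j))
      = ∑ j, w j * (a (ρ j) + τ * b (ρ j)) := by
    intro ρ
    rw [Finset.mul_sum, ← Finset.sum_add_distrib]
    exact Finset.sum_congr rfl fun j _ => by ring
  rw [listScore_ofFn, listScore_ofFn, cs, cs, hcs, hcs]
  simpa using h1

/-- The pair of scores of a list. -/
def listScores (w a b : Fin n → ℝ) (l : List (Fin n)) : ℝ × ℝ :=
  (listScore w a l, listScore w b l)

/-- The convex hull of the pairs of scores of all rankings. -/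
def scoreHull (w a b : Fin n → ℝ) : Set (ℝ × ℝ) :=
  convexHull ℝ (Set.range fun π : Equiv.Perm (Fin n) => (cs w a π, cs w b π))

theorem listScores_mem {w a b : Fin n → ℝ} {l : List (Fin n)} (hl : l.Perm (List.finRange n)) :
    listScores w a b l ∈ scoreHull w a b := by
  obtain ⟨π, rfl⟩ := exists_perm_of_perm hl
  refine subset_convexHull ℝ _ ⟨π, ?_⟩
  simp [listScores, listScore_ofFn, cs]

/-- A linear inequality valid for all rankings passes to their convex hull. -/
theorem SortedAt.le_of_mem_scoreHull {w a b : Fin n → ℝ} (hw : Antitone w) {τ : ℝ}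
    {l : List (Fin n)} (hl : l.Perm (List.finRange n)) (hs : SortedAt a b τ l) {z : ℝ × ℝ}
    (hz : z ∈ scoreHull w a b) :
    z.1 + τ * z.2 ≤ listScore w a l + τ * listScore w b l := by
  have hconv : Convex ℝ {z : ℝ × ℝ | z.1 + τ * z.2 ≤ listScore w a l + τ * listScore w b l} :=
    convex_halfSpace_le ⟨fun x y => by simp; ring, fun c x => by simp; ring⟩ _
  refine convexHull_min ?_ hconv hz
  rintro _ ⟨σ, rfl⟩
  exact hs.le_listScore hw hl σ

/-- At the swap that is chosen according to a positive vector field, the raised scores dominate a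
point at which the vector field points out of the convex hull of the scores. -/
theorem exists_stationary {w a b : Fin n → ℝ} (hw : Antitone w) (ha : ∀ j, 0 ≤ a j)
    (hb : ∀ j, 0 ≤ b j) {l : List (Fin n)} {c : List (Swap (Fin n))} (hc : Chain a b l c)
    (hperm : l.Perm (List.finRange n)) (hl : l.Pairwise fun u v => b v ≤ b u)
    {H : ℝ × ℝ → ℝ × ℝ} (hH : ContinuousOn H (scoreHull w a b))
    (hpos : ∀ z ∈ scoreHull w a b, 0 < (H z).1 ∧ 0 < (H z).2)
    {p : Swap (Fin n) → Prop} [DecidablePred p]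
    (hp : ∀ σ ∈ c, (p σ ↔ 0 < (H (listScores w a b σ.after)).1 * (a σ.snd - a σ.fst) +
      (H (listScores w a b σ.after)).2 * (b σ.snd - b σ.fst)))
    {σ₀ : Swap (Fin n)} (hσ₀ : σ₀.before = l) :
    ∃ z ∈ scoreHull w a b, z.1 ≤ raisedScore w a (choose p σ₀ c) ∧
      z.2 ≤ raisedScore w b (choose p σ₀ c) ∧ ∀ z' ∈ scoreHull w a b,
        (H z).1 * (z'.1 - z.1) + (H z).2 * (z'.2 - z.2) ≤ 0 := by
  classical
  have hbefore : ∀ σ ∈ σ₀ :: c, σ.before.Perm (List.finRange n) := by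
    intro σ hσ
    rcases List.mem_cons.1 hσ with rfl | hσ
    · rwa [hσ₀]
    · exact hc.perm hperm σ hσ
  have hlt : ∀ σ ∈ c, b σ.fst < b σ.snd := by
    clear hp hperm hl hσ₀ hbefore
    induction hc with
    | start => simp
    | step _ h _ ih => simpa [h] using ih
  have hafter : ∀ σ ∈ σ₀ :: c, listScores w a b σ.after ∈ scoreHull w a b := fun σ hσ =>
    listScores_mem (σ.after_perm.trans (hbefore σ hσ))
  -- The field is parallel to `(1, τ)` exactly when its ratio is `τ`, so `r` is the time at which a
  -- list would be stationary. The value 0 off the hull is a default that keeps `r` nonnegative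
  -- everywhere.
  let r : List (Fin n) → ℝ := fun l =>
    if listScores w a b l ∈ scoreHull w a b then
      (H (listScores w a b l)).2 / (H (listScores w a b l)).1 else 0
  have hr : ∀ l, 0 ≤ r l := by
    intro l
    simp only [r]
    split_ifs with h
    · exact div_nonneg (hpos _ h).2.le (hpos _ h).1.le
    · exact le_rfl
  obtain ⟨σ, hσ, hcase⟩ := hc.choose_spec hl hr (p := p) (fun σ hσ => by
    have h1 := hafter σ (by simp [hσ])
    have h2 := hpos _ h1
    have h3 := hlt σ hσ
    simp only [hp σ hσ, r, h1, if_true, Swap.time]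
    rw [div_lt_div_iff₀ (by linarith) h2.1]
    constructor <;> intro h <;> nlinarith) hσ₀
  have hmem : σ ∈ σ₀ :: c := hσ ▸ choose_mem
  rw [← hσ]
  have hbp := hbefore σ hmem
  have hbm : listScores w a b σ.before ∈ scoreHull w a b := listScores_mem hbp
  have ham := hafter σ hmem
  have hg := gap_nonneg hw σ.pre.length
  have hlen : σ.before.length = n := by simpa using hbp.length_eq
  rcases hcase with hs | ⟨hlt, hs, h1, h2⟩
  -- The list is optimal for its own direction; its score is the stationary point, and raising a
  -- weight only increases it.
  · refine ⟨_, hbm, ?_, ?_, fun z' hz' => ?_⟩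
    · exact le_add_of_nonneg_right (mul_nonneg hg (ha _))
    · exact le_add_of_nonneg_right (mul_nonneg hg (hb _))
    · have h := hs.le_of_mem_scoreHull hw hbp hz'
      obtain ⟨h1, h2⟩ := hpos _ hbm
      simp only [r, hbm, if_true] at h
      have h3 := mul_le_mul_of_nonneg_left h h1.le
      rw [mul_add, mul_add, ← mul_assoc, ← mul_assoc, mul_div_cancel₀ _ h1.ne'] at h3
      simp only [listScores] at h3 ⊢
      linarith
  -- The segment `γ` joins the scores before and after the swap. The ratio of the field passes the
  -- swap time on it, and at such a point the field is orthogonal to a supporting line of the hull.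
  · let γ : ℝ → ℝ × ℝ := fun θ =>
      listScores w a b σ.before + θ • (listScores w a b σ.after - listScores w a b σ.before)
    have hγ : ∀ θ ∈ Set.Icc (0 : ℝ) 1, γ θ ∈ scoreHull w a b := fun θ hθ =>
      (convex_convexHull ℝ _).add_smul_sub_mem hbm ham hθ
    have hγc : ContinuousOn (fun θ => (H (γ θ)).2 / (H (γ θ)).1) (Set.Icc 0 1) := by
      have : ContinuousOn (fun θ => H (γ θ)) (Set.Icc 0 1) :=
        hH.comp (by fun_prop) hγ
      exact this.snd.div this.fst fun θ hθ => (hpos _ (hγ θ hθ)).1.ne'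
    have hγ0 : γ 0 = listScores w a b σ.before := by simp [γ]
    have hγ1 : γ 1 = listScores w a b σ.after := by simp [γ]
    simp only [r, hbm, ham, if_true] at h1 h2
    obtain ⟨θ, hθ, hτ⟩ := intermediate_value_Icc' zero_le_one hγc
      (show σ.time a b ∈ Set.Icc _ _ by rw [hγ0, hγ1]; exact ⟨h2, h1⟩)
    have e1 : (γ θ).1 = listScore w a σ.before + θ * (gap w σ.pre.length * (a σ.snd - a σ.fst)) := by
      simp [γ, listScores, listScore_after w a σ hlen]
    have e2 : (γ θ).2 = listScore w b σ.before + θ * (gap w σ.pre.length * (b σ.snd - b σ.fst)) := by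
      simp [γ, listScores, listScore_after w b σ hlen]
    -- On the segment the gain is at most `gap * d σ.snd`, as `θ ≤ 1` and `d σ.fst ≥ 0`. This is
    -- exactly the gain from raising the weight.
    have hdom : ∀ d : Fin n → ℝ, (∀ j, 0 ≤ d j) → listScore w d σ.before +
        θ * (gap w σ.pre.length * (d σ.snd - d σ.fst)) ≤ raisedScore w d σ := by
      intro d hd
      have h3 := mul_nonneg hg (hd σ.snd)
      have h4 := mul_nonneg hg (hd σ.fst)
      have h5 := mul_nonneg hθ.1 h4
      have h6 := mul_le_mul_of_nonneg_right hθ.2 h3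
      unfold raisedScore
      linarith
    refine ⟨γ θ, hγ θ hθ, e1 ▸ hdom a ha, e2 ▸ hdom b hb, fun z' hz' => ?_⟩
    have h := hs.le_of_mem_scoreHull hw hbp hz'
    have ht := Swap.time_spec (x := a) hlt
    obtain ⟨hp1, hp2⟩ := hpos _ (hγ θ hθ)
    have hH2 : (H (γ θ)).2 = (H (γ θ)).1 * σ.time a b := by
      rw [← hτ]
      field_simp
    -- The functional of the swap time is constant along the segment, because the swapped items tie.
    have e3 : (γ θ).1 + σ.time a b * (γ θ).2
        = listScore w a σ.before + σ.time a b * listScore w b σ.before := by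
      rw [e1, e2]
      linear_combination -(θ * gap w σ.pre.length) * ht
    rw [hH2]
    have h7 : z'.1 + σ.time a b * z'.2 ≤ (γ θ).1 + σ.time a b * (γ θ).2 := e3 ▸ h
    have h3 := mul_le_mul_of_nonneg_left h7 hp1.le
    linarith

end Scores

/-! ### The relaxed optimization problem -/

section Objective

variable {D : Set (ℝ × ℝ)}

theorem IsQuadrant.convex (hD : IsQuadrant D) : Convex ℝ D := by
  rcases hD with rfl | rfl
  · exact (convex_Ici 0).prod (convex_Ici 0)
  · exact (convex_Ioi 0).prod (convex_Ioi 0)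

theorem IsQuadrant.nonneg (hD : IsQuadrant D) {z : ℝ × ℝ} (hz : z ∈ D) : 0 ≤ z.1 ∧ 0 ≤ z.2 := by
  rcases hD with rfl | rfl
  · exact hz
  · exact ⟨le_of_lt hz.1, le_of_lt hz.2⟩

theorem IsQuadrant.mem_of_le (hD : IsQuadrant D) {z z' : ℝ × ℝ} (hz : z ∈ D) (h1 : z.1 ≤ z'.1)
    (h2 : z.2 ≤ z'.2) : z' ∈ D := by
  rcases hD with rfl | rfl
  · exact ⟨le_trans hz.1 h1, le_trans hz.2 h2⟩
  · exact ⟨lt_of_lt_of_le hz.1 h1, lt_of_lt_of_le hz.2 h2⟩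

variable {f : ℝ × ℝ → ℝ} {g : ℝ × ℝ → ℝ × ℝ}

theorem IsObjectiveOn.continuousOn (hf : IsObjectiveOn D f g) : ContinuousOn f D :=
  fun z hz => (hf.hasGrad z hz).continuousWithinAt

/-- The tangent inequality for concave functions, derived on the segment from `z` to `z'` so that
one-sided derivatives at boundary points suffice. -/
theorem IsObjectiveOn.le_add_grad (hf : IsObjectiveOn D f g) {z z' : ℝ × ℝ} (hz : z ∈ D)
    (hz' : z' ∈ D) : f z' ≤ f z + ((g z).1 * (z'.1 - z.1) + (g z).2 * (z'.2 - z.2)) := by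
  have hconv := hf.concave.1
  have hmaps : Set.MapsTo (fun θ : ℝ => z + θ • (z' - z)) (Set.Icc 0 1) D := fun θ hθ =>
    hconv.add_smul_sub_mem hz hz' hθ
  have hline : HasDerivWithinAt (fun θ : ℝ => z + θ • (z' - z)) (z' - z) (Set.Icc 0 1) 0 := by
    simpa using ((hasDerivAt_id (0 : ℝ)).smul_const (z' - z)).const_add z |>.hasDerivWithinAt
  have hgrad := hf.hasGrad z hz
  have hcomp : HasDerivWithinAt (fun θ : ℝ => f (z + θ • (z' - z)))
      ((g z).1 * (z'.1 - z.1) + (g z).2 * (z'.2 - z.2)) (Set.Icc 0 1) 0 := by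
    have h0 : z = z + (0 : ℝ) • (z' - z) := by simp
    rw [h0] at hgrad
    have := hgrad.comp_hasDerivWithinAt (0 : ℝ) hline hmaps
    refine (this.congr_deriv ?_ : _)
    simp
  have hder := hcomp.sub (((hasDerivAt_id (0 : ℝ)).mul_const (f z' - f z)).hasDerivWithinAt
    (s := Set.Icc 0 1))
  -- By concavity the function lies above its chord, with equality at 0, so the one-sided derivative
  -- of the difference there is nonnegative.
  have hmin : IsMinOn ((fun θ : ℝ => f (z + θ • (z' - z))) - fun θ : ℝ => id θ * (f z' - f z))
      (Set.Icc 0 1) 0 := by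
    intro θ hθ
    have h1 := hf.concave.2 hz hz' (show 0 ≤ 1 - θ by linarith [hθ.2]) hθ.1
      (by ring)
    have h2 : (1 - θ) • z + θ • z' = z + θ • (z' - z) := by
      rw [smul_sub, sub_smul, one_smul]
      abel
    rw [h2] at h1
    simp only [smul_eq_mul] at h1
    simp only [Set.mem_ofPred_eq, Pi.sub_apply, id, zero_smul, add_zero, zero_mul, sub_zero]
    linarith
  have hone : (1 : ℝ) ∈ posTangentConeAt (Set.Icc (0 : ℝ) 1) 0 :=
    mem_posTangentConeAt_of_segment_subset (by simp [segment_eq_Icc])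
  have := hmin.localize.hasFDerivWithinAt_nonneg hder.hasFDerivWithinAt hone
  simp at this
  linarith

/-- A unit step in a coordinate stays in the quadrant and strictly increases `f`; by the tangent
inequality the increase is at most the partial derivative. -/
theorem IsObjectiveOn.grad_pos (hD : IsQuadrant D) (hf : IsObjectiveOn D f g) {z : ℝ × ℝ}
    (hz : z ∈ D) : 0 < (g z).1 ∧ 0 < (g z).2 := by
  constructor
  · have hz' : (z.1 + 1, z.2) ∈ D := hD.mem_of_le hz (by simp) le_rfl
    have h1 := hf.strictMono_fst z.1 (z.1 + 1) z.2 hz hz' (by linarith)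
    have h2 := hf.le_add_grad hz hz'
    simp only [add_sub_cancel_left, sub_self, mul_zero, add_zero, mul_one] at h2
    linarith
  · have hz' : (z.1, z.2 + 1) ∈ D := hD.mem_of_le hz le_rfl (by simp)
    have h1 := hf.strictMono_snd z.1 z.2 (z.2 + 1) hz hz' (by linarith)
    have h2 := hf.le_add_grad hz hz'
    simp only [add_sub_cancel_left, sub_self, mul_zero, zero_add, mul_one] at h2
    linarith

theorem IsObjectiveOn.mono (hD : IsQuadrant D) (hf : IsObjectiveOn D f g) {z z' : ℝ × ℝ}
    (hz : z ∈ D) (h1 : z.1 ≤ z'.1) (h2 : z.2 ≤ z'.2) : f z ≤ f z' := by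
  have hz' := hD.mem_of_le hz h1 h2
  have h := hf.le_add_grad hz' hz
  obtain ⟨h3, h4⟩ := hf.grad_pos hD hz'
  nlinarith

theorem IsObjectiveOn.grad_antitone (hf : IsObjectiveOn D f g) {z z' : ℝ × ℝ} (hz : z ∈ D)
    (hz' : z' ∈ D) :
    ((g z).1 - (g z').1) * (z.1 - z'.1) + ((g z).2 - (g z').2) * (z.2 - z'.2) ≤ 0 := by
  have h1 := hf.le_add_grad hz hz'
  have h2 := hf.le_add_grad hz' hz
  linarith

end Objective

/-- A strictly concave function, a small multiple of which is added to the local functions. -/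
noncomputable def psi (z : ℝ × ℝ) : ℝ := Real.log (1 + z.1) + Real.log (1 + z.2)

/-- The gradient of `psi`. -/
noncomputable def gradPsi (z : ℝ × ℝ) : ℝ × ℝ := (1 / (1 + z.1), 1 / (1 + z.2))

theorem hasFDerivAt_psi {z : ℝ × ℝ} (h1 : 0 ≤ z.1) (h2 : 0 ≤ z.2) : HasFDerivAt psi
    ((gradPsi z).1 • ContinuousLinearMap.fst ℝ ℝ ℝ + (gradPsi z).2 • ContinuousLinearMap.snd ℝ ℝ ℝ)
    z := by
  have e1 := ((hasFDerivAt_fst (𝕜 := ℝ) (p := z)).const_add (1 : ℝ)).log (by positivity)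
  have e2 := ((hasFDerivAt_snd (𝕜 := ℝ) (p := z)).const_add (1 : ℝ)).log (by positivity)
  refine (e1.add e2).congr_fderiv ?_
  simp [gradPsi]

theorem psi_nonneg {z : ℝ × ℝ} (h1 : 0 ≤ z.1) (h2 : 0 ≤ z.2) : 0 ≤ psi z :=
  add_nonneg (Real.log_nonneg (by linarith)) (Real.log_nonneg (by linarith))

/-- The equality case gives uniqueness of stationary points. Only the rational gradient of `psi`
enters the program, so no logarithm has to be computed. -/
theorem inv_one_add_antitone {s t : ℝ} (hs : 0 ≤ s) (ht : 0 ≤ t) :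
    (1 / (1 + s) - 1 / (1 + t)) * (s - t) ≤ 0 ∧
      ((1 / (1 + s) - 1 / (1 + t)) * (s - t) = 0 → s = t) := by
  have h : (1 / (1 + s) - 1 / (1 + t)) * (s - t) = -((s - t) ^ 2 / ((1 + s) * (1 + t))) := by
    field_simp
    ring
  rw [h]
  refine ⟨neg_nonpos.2 (by positivity), fun h0 => ?_⟩
  have : (1 + s) * (1 + t) ≠ 0 := by positivity
  rw [neg_eq_zero, div_eq_zero_iff, or_iff_left this, sq_eq_zero_iff] at h0
  linarith

/-! ### Decoupling the instances by prices -/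

namespace Instance

variable {m n : ℕ} (I : Instance m n)

/-- The convex hull of the pairs of scores of the `i`-th instance. -/
def hull (i : Fin m) : Set (ℝ × ℝ) := scoreHull (I.w i) (I.a i) (I.b i)

/-- The gradient of the sum of a linear function, the `i`-th local function and a multiple
of `psi`. -/
noncomputable def field (g : ℝ × ℝ) (ε : ℝ) (i : Fin m) (z : ℝ × ℝ) : ℝ × ℝ :=
  g + I.gradf i z + ε • gradPsi z

variable {I}

theorem isCompact_hull (i : Fin m) : IsCompact (I.hull i) :=
  (Set.finite_range _).isCompact_convexHull (𝕜 := ℝ)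

theorem scores_mem_hull (π : Fin m → Equiv.Perm (Fin n)) (i : Fin m) :
    I.scores I.w π i ∈ I.hull i :=
  subset_convexHull ℝ _ ⟨π i, rfl⟩

theorem globalScores_eq (π : Fin m → Equiv.Perm (Fin n)) :
    I.globalScores I.w π = ∑ i, I.scores I.w π i := by
  ext <;> simp [globalScores, scores, Prod.fst_sum, Prod.snd_sum]

theorem hull_subset {D : Set (ℝ × ℝ)} (hD : IsQuadrant D) {i : Fin m}
    (h : ∀ π, I.scores I.w π i ∈ D) : I.hull i ⊆ D := by
  refine convexHull_min ?_ hD.convex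
  rintro _ ⟨σ, rfl⟩
  exact h fun _ => σ

/-- The product of the hulls is the hull of the products of vertices, so the assumption on rankings
extends to all relaxed points. -/
theorem sum_mem {D : Set (ℝ × ℝ)} (hD : IsQuadrant D) (h : ∀ π, I.globalScores I.w π ∈ D)
    {x : Fin m → ℝ × ℝ} (hx : ∀ i, x i ∈ I.hull i) : ∑ i, x i ∈ D := by
  have hx' : x ∈ convexHull ℝ (Set.univ.pi fun i => Set.range fun π : Equiv.Perm (Fin n) =>
      (cs (I.w i) (I.a i) π, cs (I.w i) (I.b i) π)) := by
    rw [convexHull_pi]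
    exact fun i _ => hx i
  have hconv : Convex ℝ {x : Fin m → ℝ × ℝ | ∑ i, x i ∈ D} :=
    hD.convex.is_linear_preimage (f := fun x : Fin m → ℝ × ℝ => ∑ i, x i)
      ⟨fun x y => by simp [Finset.sum_add_distrib], fun c x => by simp [Finset.smul_sum]⟩
  refine convexHull_min ?_ hconv hx'
  intro y hy
  choose π hπ using fun i => hy i (Set.mem_univ i)
  have := h π
  rw [globalScores_eq] at this
  simpa [scores, hπ] using this

theorem sum_update {E : Type*} [AddCommGroup E] (G : Fin m → ℝ × ℝ → E) (x : Fin m → ℝ × ℝ)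
    (i : Fin m) (z : ℝ × ℝ) :
    ∑ j, G j (Function.update x i z j) = (∑ j, G j (x j) - G i (x i)) + G i z := by
  have h : ∑ j, (G j (Function.update x i z j) - G j (x j)) = G i z - G i (x i) := by
    rw [Finset.sum_eq_single i]
    · simp
    · intro j _ hj
      simp [Function.update_of_ne hj]
    · simp
  rw [Finset.sum_sub_distrib, sub_eq_iff_eq_add] at h
  rw [h]
  abel

theorem continuousOn_gradPsi {K : Set (ℝ × ℝ)} (h : ∀ z ∈ K, 0 ≤ z.1 ∧ 0 ≤ z.2) :
    ContinuousOn gradPsi K := by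
  refine ContinuousOn.prodMk ?_ ?_
  · exact continuousOn_const.div (by fun_prop) fun z hz => by have := (h z hz).1; positivity
  · exact continuousOn_const.div (by fun_prop) fun z hz => by have := (h z hz).2; positivity

/-- For every `ε > 0` there is a price vector `g` such that points that are locally optimal
for the prices `g`, and even larger points, are globally optimal up to `ε * M`. -/
theorem Valid.exists_prices (hI : I.Valid) : ∃ M : ℝ, ∀ ε > 0, ∃ g : ℝ × ℝ,
    (∀ i, ContinuousOn (I.field g ε i) (I.hull i)) ∧
    (∀ i, ∀ z ∈ I.hull i, 0 < (I.field g ε i z).1 ∧ 0 < (I.field g ε i z).2) ∧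
    ∀ u : Fin m → ℝ × ℝ, (∀ i, ∃ z ∈ I.hull i, z.1 ≤ (u i).1 ∧ z.2 ≤ (u i).2 ∧
      ∀ z' ∈ I.hull i, (I.field g ε i z).1 * (z'.1 - z.1) +
        (I.field g ε i z).2 * (z'.2 - z.2) ≤ 0) →
      ∀ π, I.co I.w π ≤ I.F (∑ i, (u i).1, ∑ i, (u i).2) + ∑ i, I.f i (u i) + ε * M := by
  choose D hD hf hDmem using hI.objective_f
  obtain ⟨DF, hDF, hF, hDFmem⟩ := hI.objective_F
  have hsub : ∀ i, I.hull i ⊆ D i := fun i => hull_subset (hD i) (hDmem i)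
  have hnn : ∀ i, ∀ z ∈ I.hull i, 0 ≤ z.1 ∧ 0 ≤ z.2 := fun i z hz => (hD i).nonneg (hsub i hz)
  have hK : IsCompact (Set.univ.pi I.hull) := isCompact_univ_pi fun i => isCompact_hull i
  have hne : (Set.univ.pi I.hull).Nonempty :=
    ⟨_, fun i _ => scores_mem_hull (fun _ => Equiv.refl _) i⟩
  have hcoord : ∀ i, ContinuousOn (fun x : Fin m → ℝ × ℝ => x i) (Set.univ.pi I.hull) :=
    fun i => (continuous_apply i).continuousOn
  have hpsic : ∀ i, ContinuousOn (fun x : Fin m → ℝ × ℝ => psi (x i)) (Set.univ.pi I.hull) :=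
    fun i => ContinuousOn.comp (t := I.hull i) (fun z hz =>
      (hasFDerivAt_psi (hnn i z hz).1 (hnn i z hz).2).continuousAt.continuousWithinAt) (hcoord i)
      fun x hx => hx i (Set.mem_univ i)
  have hfc : ∀ i, ContinuousOn (fun x : Fin m → ℝ × ℝ => I.f i (x i)) (Set.univ.pi I.hull) :=
    fun i => (hf i).continuousOn.comp (hcoord i) fun x hx => hsub i (hx i (Set.mem_univ i))
  have hFc : ContinuousOn (fun x : Fin m → ℝ × ℝ => I.F (∑ i, x i)) (Set.univ.pi I.hull) :=
    hF.continuousOn.comp (by fun_prop) fun x hx =>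
      sum_mem hDF hDFmem fun i => hx i (Set.mem_univ i)
  -- `M` bounds the perturbation on the whole product of hulls and is fixed before `ε`.
  obtain ⟨M, hM⟩ := (hK.image_of_continuousOn
    (continuousOn_finsetSum Finset.univ fun i _ => hpsic i)).bddAbove
  refine ⟨M, fun ε hε => ?_⟩
  obtain ⟨x, hx, hmax⟩ := hK.exists_isMaxOn hne (f := fun x : Fin m → ℝ × ℝ =>
    I.F (∑ i, x i) + (∑ i, I.f i (x i) + ε * ∑ i, psi (x i)))
    (hFc.add ((continuousOn_finsetSum Finset.univ fun i _ => hfc i).add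
      ((continuousOn_finsetSum Finset.univ fun i _ => hpsic i).const_mul ε)))
  replace hx : ∀ i, x i ∈ I.hull i := fun i => hx i (Set.mem_univ i)
  have hX : ∑ i, x i ∈ DF := sum_mem hDF hDFmem hx
  -- `F` depends on the total only, so all instances see the same price vector.
  set g := I.gradF (∑ i, x i) with hg
  have hgpos := hF.grad_pos hDF hX
  have hstat : ∀ i, ∀ z ∈ I.hull i, (I.field g ε i (x i)).1 * (z.1 - (x i).1) +
      (I.field g ε i (x i)).2 * (z.2 - (x i).2) ≤ 0 := by
    intro i z hz
    have hupd : ∀ z ∈ I.hull i, ∀ j, Function.update x i z j ∈ I.hull j := by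
      intro z hz j
      rcases eq_or_ne j i with rfl | hj
      · simpa using hz
      · simpa [Function.update_of_ne hj] using hx j
    have hmaps : Set.MapsTo (fun z => (∑ j, x j - x i) + z) (I.hull i) DF := by
      intro z hz
      have := sum_mem hDF hDFmem (hupd z hz)
      rwa [sum_update (fun _ z => z)] at this
    -- Optimality when only the `i`-th point varies; its first-order condition is the stationarity
    -- of `x i`.
    have hloc : IsMaxOn (fun z => I.F ((∑ j, x j - x i) + z) + (I.f i z + ε * psi z))
        (I.hull i) (x i) := by
      intro z hz
      have := hmax (a := Function.update x i z) fun j _ => hupd z hz j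
      simp only [Set.mem_ofPred_eq] at this ⊢
      rw [sum_update (fun _ z => z), sum_update I.f, sum_update (fun _ => psi)] at this
      rw [sub_add_cancel]
      linarith
    have hFd := hF.hasGrad _ hX
    have e0 : ∑ j, x j = (∑ j, x j - x i) + x i := by simp
    have hFd' : HasFDerivWithinAt (fun z => I.F ((∑ j, x j - x i) + z))
        (g.1 • ContinuousLinearMap.fst ℝ ℝ ℝ + g.2 • ContinuousLinearMap.snd ℝ ℝ ℝ)
        (I.hull i) (x i) := by
      rw [← hg, e0] at hFd
      exact hFd.comp (x i) ((hasFDerivWithinAt_id (𝕜 := ℝ) (x i) (I.hull i)).const_add _) hmaps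
    have hder := hFd'.add ((((hf i).hasGrad _ (hsub i (hx i))).mono (hsub i)).add
      ((hasFDerivAt_psi (hnn i _ (hx i)).1 (hnn i _ (hx i)).2).hasFDerivWithinAt.const_mul ε))
    have hcone : z - x i ∈ posTangentConeAt (I.hull i) (x i) :=
      sub_mem_posTangentConeAt_of_segment_subset
        ((convex_convexHull ℝ _).segment_subset (hx i) hz)
    have := hloc.localize.hasFDerivWithinAt_nonpos hder hcone
    simp only [add_apply, smul_apply, smul_eq_mul,
      ContinuousLinearMap.coe_fst', ContinuousLinearMap.coe_snd', Prod.fst_sub, Prod.snd_sub]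
      at this
    simp only [field, Prod.fst_add, Prod.snd_add, Prod.smul_fst, Prod.smul_snd, smul_eq_mul]
    linarith
  refine ⟨g, fun i => ?_, fun i z hz => ?_, fun u hu π => ?_⟩
  · exact (continuousOn_const.add ((hf i).contGrad.mono (hsub i))).add
      ((continuousOn_gradPsi (hnn i)).const_smul ε)
  · have h1 := (hf i).grad_pos (hD i) (hsub i hz)
    obtain ⟨h2, h3⟩ := hnn i z hz
    simp only [field, gradPsi, Prod.fst_add, Prod.snd_add, Prod.smul_fst, Prod.smul_snd,
      smul_eq_mul]
    exact ⟨add_pos (add_pos hgpos.1 h1.1) (by positivity),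
      add_pos (add_pos hgpos.2 h1.2) (by positivity)⟩
  · have hxu : ∀ i, (x i).1 ≤ (u i).1 ∧ (x i).2 ≤ (u i).2 := by
      intro i
      obtain ⟨z, hz, h1, h2, h3⟩ := hu i
      have h4 := h3 _ (hx i)
      have h5 := hstat i z hz
      have h6 := (hf i).grad_antitone (hsub i hz) (hsub i (hx i))
      obtain ⟨h7, h7'⟩ := inv_one_add_antitone (hnn i _ hz).1 (hnn i _ (hx i)).1
      obtain ⟨h8, h8'⟩ := inv_one_add_antitone (hnn i _ hz).2 (hnn i _ (hx i)).2
      simp only [field, gradPsi, Prod.fst_add, Prod.snd_add, Prod.smul_fst, Prod.smul_snd,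
        smul_eq_mul] at h4 h5
      -- Adding the stationarity conditions of `z` and `x i` cancels `g`. The part from `f i` is at
      -- most 0, so the strictly monotone part from `psi` has to vanish and `z = x i`.
      have h9 : 0 ≤ ε * ((1 / (1 + z.1) - 1 / (1 + (x i).1)) * (z.1 - (x i).1) +
          (1 / (1 + z.2) - 1 / (1 + (x i).2)) * (z.2 - (x i).2)) := by
        linarith
      have h10 := nonneg_of_mul_nonneg_right h9 hε
      have e1 := h7' (by linarith)
      have e2 := h8' (by linarith)
      exact ⟨e1 ▸ h1, e2 ▸ h2⟩
    have hscores := hmax (a := fun i => I.scores I.w π i) fun i _ => scores_mem_hull π i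
    simp only [Set.mem_ofPred_eq, ← globalScores_eq] at hscores
    -- The perturbation is nonnegative at rankings and at most `ε * M` at `x`, hence the error `ε *
    -- M`.
    have h1 : 0 ≤ ε * ∑ i, psi (I.scores I.w π i) := by
      refine mul_nonneg hε.le (Finset.sum_nonneg fun i _ => ?_)
      have := hnn i _ (scores_mem_hull π i)
      exact psi_nonneg this.1 this.2
    have h2 : ∑ i, psi (x i) ≤ M := hM ⟨x, fun i _ => hx i, rfl⟩
    have h3 : I.F (∑ i, x i) ≤ I.F (∑ i, (u i).1, ∑ i, (u i).2) := by
      refine hF.mono hDF hX ?_ ?_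
      · rw [Prod.fst_sum]
        exact Finset.sum_le_sum fun i _ => (hxu i).1
      · rw [Prod.snd_sum]
        exact Finset.sum_le_sum fun i _ => (hxu i).2
    have h4 : ∑ i, I.f i (x i) ≤ ∑ i, I.f i (u i) := Finset.sum_le_sum fun i _ =>
      (hf i).mono (hD i) (hsub i (hx i)) (hxu i).1 (hxu i).2
    have h5 := mul_le_mul_of_nonneg_left h2 hε.le
    unfold co
    linarith

end Instance

/-! ### The algorithm -/

/-- What the algorithm stores for a swap: the affine function whose sign decides whether the swap
is passed, the raised scores, the value of the local function there, and the ranking. -/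
structure Link (n : ℕ) where
  aff : Aff 3
  fst : ℝ
  snd : ℝ
  val : ℝ
  order : List (Fin n)

namespace Instance

variable {m n : ℕ} (I : Instance m n)

/-- The point with the coordinates `g.1`, `g.2`, `ε`. -/
def point (g : ℝ × ℝ) (ε : ℝ) : Pt 3 := .cons g.1 (.cons g.2 (.cons ε .nil))

/-- The affine function whose value at `point g ε` is the product of the vector `I.field g ε i` after
the swap with the difference of the swapped items. -/
noncomputable def affOf (i : Fin m) (σ : Swap (Fin n)) : Aff 3 :=
  .cons (I.a i σ.snd - I.a i σ.fst) (.cons (I.b i σ.snd - I.b i σ.fst) (.cons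
    ((I.a i σ.snd - I.a i σ.fst) / (1 + listScore (I.w i) (I.a i) σ.after) +
      (I.b i σ.snd - I.b i σ.fst) / (1 + listScore (I.w i) (I.b i) σ.after))
    (.const ((I.gradf i (listScores (I.w i) (I.a i) (I.b i) σ.after)).1 *
        (I.a i σ.snd - I.a i σ.fst) +
      (I.gradf i (listScores (I.w i) (I.a i) (I.b i) σ.after)).2 *
        (I.b i σ.snd - I.b i σ.fst)))))

/-- The data of a swap of the `i`-th instance. -/
noncomputable def link (i : Fin m) (σ : Swap (Fin n)) : Link n where
  aff := I.affOf i σ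
  fst := raisedScore (I.w i) (I.a i) σ
  snd := raisedScore (I.w i) (I.b i) σ
  val := I.f i (raisedScore (I.w i) (I.a i) σ, raisedScore (I.w i) (I.b i) σ)
  order := σ.before

/-- The results of the `i`-th instance, sorted by `a`. -/
noncomputable def sorted (i : Fin m) : List (Fin n) :=
  -- With a constant first function all swap times are 0, and the swaps of neighbours just sort by
  -- `a`. The number of inversions is at most `n * n`. The reversed initial list is what a fold that
  -- conses produces.
  (swapStep (fun _ => 0) (I.a i))^[n * n] (List.finRange n).reverse

/-- The final list and the sequence of swaps of the `i`-th instance. -/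
noncomputable def chain (i : Fin m) : List (Fin n) × List (Swap (Fin n)) :=
  (chainStep (I.a i) (I.b i))^[n * n] (I.sorted i, [])

/-- The split of a list after its first element. -/
def firstSwap (hn : 2 ≤ n) : List (Fin n) → Swap (Fin n)
  -- No swap follows the final list. An artificial swap in front makes it a `Link` too, and any
  -- raised weight is good enough there. The other branch is a default not reached for lists of
  -- length `n`.
  | u :: v :: s => ⟨[], u, v, s⟩
  | _ => ⟨[], ⟨0, by omega⟩, ⟨1, by omega⟩, []⟩

/-- The data for the final list and for all swaps of the `i`-th instance. -/
noncomputable def stack (hn : 2 ≤ n) (i : Fin m) : Link n × List (Link n) :=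
  (I.link i (firstSwap hn (I.chain i).1), (I.chain i).2.map (I.link i))

end Instance

/-- The affine functions of all swaps. -/
def collectAffs {n : ℕ} (S : List (Link n × List (Link n))) : List (Aff 3) :=
  S.foldl (fun acc s => (s.1 :: s.2).foldl (fun acc k => k.aff :: acc) acc) []

open Classical in
/-- The link that is chosen at a point. -/
noncomputable def chooseAt {n : ℕ} (x : Pt 3) (s : Link n × List (Link n)) : Link n :=
  choose (fun k : Link n => 0 < k.aff.eval x) s.1 s.2

/-- Sums of scores and values, and a list of rankings. -/
abbrev Tally (n : ℕ) := ℝ × ℝ × ℝ × List (List (Fin n))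

/-- Add a link. -/
def Tally.add {n : ℕ} (c : Tally n) (k : Link n) : Tally n :=
  (c.1 + k.fst, c.2.1 + k.snd, c.2.2.1 + k.val, k.order :: c.2.2.2)

/-- The tally of the links that are chosen at a point. -/
noncomputable def candidate {n : ℕ} (S : List (Link n × List (Link n))) (x : Pt 3) : Tally n :=
  S.foldl (fun c s => c.add (chooseAt x s)) (0, 0, 0, [])

open Classical in
/-- Keep the better one of two pairs. -/
noncomputable def better {β : Type*} (acc : Option (ℝ × β)) (c : ℝ × β) : Option (ℝ × β) :=
  match acc with
  | none => some c
  | some d => if d.1 < c.1 then some c else some d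

theorem foldl_better {β : Type*} (l : List (ℝ × β)) (acc : Option (ℝ × β)) (hne : l ≠ [] ∨ acc ≠ none) :
    ∃ c, l.foldl better acc = some c ∧ (c ∈ l ∨ acc = some c) ∧ (∀ d ∈ l, d.1 ≤ c.1) ∧
      ∀ d, acc = some d → d.1 ≤ c.1 := by
  induction l generalizing acc with
  | nil =>
    rcases acc with _ | c
    · simp at hne
    · exact ⟨c, rfl, .inr rfl, by simp, fun d hd => by rw [Option.some.inj hd]⟩
  | cons e l ih =>
    obtain ⟨c, h1, h2, h3, h4⟩ := ih (better acc e) (.inr (by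
      unfold better
      split
      · simp
      · split_ifs <;> simp))
    rw [List.foldl_cons]
    refine ⟨c, h1, ?_, ?_, ?_⟩
    · rcases h2 with h2 | h2
      · exact .inl (by simp [h2])
      · unfold better at h2
        split at h2
        · exact .inl (by simp [← Option.some.inj h2])
        · split_ifs at h2
          · exact .inl (by simp [← Option.some.inj h2])
          · exact .inr h2
    · intro d hd
      rcases List.mem_cons.1 hd with rfl | hd
      · unfold better at h4
        split at h4
        · exact h4 _ rfl
        · split_ifs at h4 with h
          · exact h4 _ rfl
          · exact (not_lt.1 h).trans (h4 _ rfl)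
      · exact h3 d hd
    · rintro d rfl
      unfold better at h4
      dsimp only at h4
      split_ifs at h4 with h
      · exact h.le.trans (h4 _ rfl)
      · exact h4 _ rfl

theorem candidate_eq {n : ℕ} (S : List (Link n × List (Link n))) (x : Pt 3) :
    candidate S x = ((S.map fun s => (chooseAt x s).fst).sum,
      (S.map fun s => (chooseAt x s).snd).sum, (S.map fun s => (chooseAt x s).val).sum,
      (S.map fun s => (chooseAt x s).order).reverse) := by
  have key : ∀ c : Tally n, S.foldl (fun c s => c.add (chooseAt x s)) c =
      (c.1 + (S.map fun s => (chooseAt x s).fst).sum,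
      c.2.1 + (S.map fun s => (chooseAt x s).snd).sum,
      c.2.2.1 + (S.map fun s => (chooseAt x s).val).sum,
      (S.map fun s => (chooseAt x s).order).reverse ++ c.2.2.2) := by
    induction S with
    | nil => simp
    | cons s S ih =>
      intro c
      rw [List.foldl_cons, ih]
      simp [Tally.add, add_assoc]
  rw [candidate, key]
  simp

theorem mem_collectAffs {n : ℕ} {S : List (Link n × List (Link n))} {l : Aff 3} :
    l ∈ collectAffs S ↔ ∃ s ∈ S, ∃ k ∈ s.1 :: s.2, l = k.aff := by
  unfold collectAffs
  rw [mem_foldl_iff (R := fun s l => ∃ k ∈ s.1 :: s.2, l = k.aff)]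
  · simp
  · intro acc s l
    rw [mem_foldl_iff (R := fun k l => l = k.aff)]
    simp [or_comm]

theorem length_collectAffs_le {n B : ℕ} {S : List (Link n × List (Link n))}
    (h : ∀ s ∈ S, s.2.length + 1 ≤ B) : (collectAffs S).length ≤ S.length * B := by
  have key : ∀ acc : List (Aff 3), (S.foldl (fun acc s =>
      (s.1 :: s.2).foldl (fun acc k => k.aff :: acc) acc) acc).length
        ≤ acc.length + S.length * B := by
    induction S with
    | nil => simp
    | cons s S ih =>
      intro acc
      refine (ih (fun s hs => h s (by simp [hs])) _).trans ?_
      have := h s (by simp)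
      simp only [foldl_cons_map, List.length_append, List.length_reverse, List.length_map, List.length_cons]
      rw [add_mul, one_mul]
      omega
  have := key []
  rw [List.length_nil, Nat.zero_add] at this
  exact this

namespace Instance

variable {m n : ℕ} (I : Instance m n)

/-- The stacks of all instances, the last one first. -/
noncomputable def stackList (hn : 2 ≤ n) : List (Link n × List (Link n)) :=
  ((List.finRange m).map (I.stack hn)).reverse

/-- The value and the rankings of a tally. -/
def evaluate (c : Tally n) : ℝ × List (List (Fin n)) := (I.F (c.1, c.2.1) + c.2.2.1, c.2.2.2)

/-- The best one of the candidates at all sample points. -/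
noncomputable def best (hn : 2 ≤ n) : Option (ℝ × List (List (Fin n))) :=
  (samples 3 (collectAffs (I.stackList hn))).foldl
    (fun acc x => better acc (I.evaluate (candidate (I.stackList hn) x))) none

/-! ### Correctness of the algorithm -/

variable {I}

/-- The test for passing a swap is affine in the prices and `ε`, with coefficients obtained from one
gradient query at the scores after the swap. -/
theorem eval_affOf (i : Fin m) (σ : Swap (Fin n)) (g : ℝ × ℝ) (ε : ℝ) :
    (I.affOf i σ).eval (point g ε) =
      (I.field g ε i (listScores (I.w i) (I.a i) (I.b i) σ.after)).1 *
        (I.a i σ.snd - I.a i σ.fst) +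
      (I.field g ε i (listScores (I.w i) (I.a i) (I.b i) σ.after)).2 *
        (I.b i σ.snd - I.b i σ.fst) := by
  simp only [affOf, point, Aff.eval, field, gradPsi, listScores, Prod.fst_add, Prod.snd_add,
    Prod.smul_fst, Prod.smul_snd, smul_eq_mul]
  ring

theorem sorted_perm (i : Fin m) : (I.sorted i).Perm (List.finRange n) :=
  (iterate_swapStep_perm _ _).trans (List.reverse_perm _)

theorem chain_spec (i : Fin m) : Chain (I.a i) (I.b i) (I.chain i).1 (I.chain i).2 ∧
    (I.chain i).1.Pairwise fun u v => I.b i v ≤ I.b i u := by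
  refine iterate_chainStep (sortedAt_of_isChain ?_) ?_
  · have := isChain_iterate_swapStep (x := fun _ => (0 : ℝ)) (y := I.a i) (k := n * n)
      (l := (List.finRange n).reverse) (by simp)
    exact this.imp fun u v h => by simpa using h
  · rw [(sorted_perm i).length_eq, List.length_finRange]

theorem iterate_chainStep_perm {α : Type*} {x y : α → ℝ} (k : ℕ) (c : List α × List (Swap α)) :
    ((chainStep x y)^[k] c).1.Perm c.1 := by
  induction k generalizing c with
  | zero => exact .refl _
  | succ k ih =>
    refine (ih _).trans ?_
    have h := scan_spec (x := x) (y := y) c.1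
    unfold chainStep
    rcases hs : scan x y c.1 with _ | σ
    · exact .refl _
    · rw [hs] at h
      exact h.1 ▸ σ.after_perm

theorem chain_perm (i : Fin m) : (I.chain i).1.Perm (List.finRange n) :=
  (iterate_chainStep_perm _ _).trans (sorted_perm i)

theorem length_chain_le (i : Fin m) : (I.chain i).2.length ≤ n * n := by
  have := length_iterate_chainStep (x := I.a i) (y := I.b i) (n * n) (I.sorted i, [])
  rw [List.length_nil, Nat.zero_add] at this
  exact this

theorem before_firstSwap (hn : 2 ≤ n) {l : List (Fin n)} (h : l.length = n) :
    (firstSwap hn l).before = l := by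
  rcases l with _ | ⟨u, _ | ⟨v, s⟩⟩
  · simp at h
    omega
  · simp at h
    omega
  · rfl

/-- The swap that is chosen at a point. -/
noncomputable def chosen (I : Instance m n) (hn : 2 ≤ n) (x : Pt 3) (i : Fin m) : Swap (Fin n) :=
  open Classical in
  choose (fun σ => 0 < (I.affOf i σ).eval x) (firstSwap hn (I.chain i).1) (I.chain i).2

theorem chooseAt_stack (hn : 2 ≤ n) (x : Pt 3) (i : Fin m) :
    chooseAt x (I.stack hn i) = I.link i (I.chosen hn x i) := by
  classical
  exact choose_map (p := fun k : Link n => 0 < k.aff.eval x) (I.link i) _ _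

theorem chosen_perm (hn : 2 ≤ n) (x : Pt 3) (i : Fin m) :
    (I.chosen hn x i).before.Perm (List.finRange n) := by
  have h : I.chosen hn x i ∈ firstSwap hn (I.chain i).1 :: (I.chain i).2 := choose_mem
  rcases List.mem_cons.1 h with h | h
  · rw [h, before_firstSwap hn]
    · exact chain_perm i
    · simpa using (chain_perm i).length_eq
  · exact (chain_spec i).1.perm (chain_perm i) _ h

/-- Both `stackList` and the tally reverse the order of the instances, so the rankings come out in
the original order. -/
theorem evaluate_candidate (hn : 2 ≤ n) (x : Pt 3) :
    I.evaluate (candidate (I.stackList hn) x) =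
      (I.F (∑ i, raisedScore (I.w i) (I.a i) (I.chosen hn x i),
          ∑ i, raisedScore (I.w i) (I.b i) (I.chosen hn x i)) +
        ∑ i, I.f i (raisedScore (I.w i) (I.a i) (I.chosen hn x i),
          raisedScore (I.w i) (I.b i) (I.chosen hn x i)),
        List.ofFn fun i => (I.chosen hn x i).before) := by
  rw [candidate_eq, stackList, evaluate]
  simp only [List.map_reverse, List.map_ofFn, List.sum_reverse, List.reverse_reverse,
    ← List.ofFn_eq_map, Function.comp_def, chooseAt_stack, link, List.sum_ofFn]

theorem exists_rankings (hn : 2 ≤ n) (x : Pt 3) :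
    ∃ (π : Fin m → Equiv.Perm (Fin n)) (t : Fin m → Fin (n - 1)),
      I.evaluate (candidate (I.stackList hn) x) =
        (I.co (fun i => raise (I.w i) (t i)) π, List.ofFn fun i => List.ofFn (π i)) := by
  choose π t h1 h2 using fun i => Swap.exists_raise (chosen_perm (I := I) hn x i)
  refine ⟨π, t, ?_⟩
  rw [evaluate_candidate]
  simp only [co, globalScores, scores, h1, h2]

/-- For every `ε` some sample point makes the same choices as the unknown point `point g ε`, so `v`
bounds the objective up to `ε * M`. As `v` is independent of `ε`, the error disappears. -/
theorem Valid.le_of_sample (hI : I.Valid) (hn : 2 ≤ n) {v : ℝ}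
    (hv : ∀ x ∈ samples 3 (collectAffs (I.stackList hn)),
      (I.evaluate (candidate (I.stackList hn) x)).1 ≤ v) (π : Fin m → Equiv.Perm (Fin n)) :
    I.co I.w π ≤ v := by
  classical
  obtain ⟨M, hM⟩ := hI.exists_prices
  have key : ∀ ε > 0, I.co I.w π ≤ v + ε * M := by
    intro ε hε
    obtain ⟨g, hcont, hpos, hle⟩ := hM ε hε
    obtain ⟨x, hx, hsign⟩ := exists_mem_samples 3 (collectAffs (I.stackList hn)) (point g ε)
    have h1 := hv x hx
    rw [evaluate_candidate] at h1
    refine (hle (fun i => (raisedScore (I.w i) (I.a i) (I.chosen hn x i),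
      raisedScore (I.w i) (I.b i) (I.chosen hn x i))) (fun i => ?_) π).trans ?_
    · refine exists_stationary (hI.w_antitone i) (hI.a_nonneg i) (hI.b_nonneg i) (chain_spec i).1
        (chain_perm i) (chain_spec i).2 (hcont i) (hpos i) (fun σ hσ => ?_) (before_firstSwap hn ?_)
      -- The test was carried out at the sample point; equality of signs turns it into the test for
      -- the true field.
      · rw [← eval_affOf, ← sign_eq_one_iff, ← sign_eq_one_iff, hsign]
        refine mem_collectAffs.2 ⟨I.stack hn i, ?_, I.link i σ, ?_, rfl⟩
        · simp [stackList]
        · simp only [stack, List.mem_cons, List.mem_map]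
          exact .inr ⟨σ, hσ, rfl⟩
      · simpa using (chain_perm i).length_eq
    · dsimp only at h1 ⊢
      linarith
  by_contra hlt
  push Not at hlt
  rcases le_or_gt M 0 with hM0 | hM0
  · linarith [key 1 one_pos]
  · have h1 := key ((I.co I.w π - v) / (2 * M)) (div_pos (by linarith) (by linarith))
    have h2 : (I.co I.w π - v) / (2 * M) * M = (I.co I.w π - v) / 2 := by
      field_simp
    linarith

/-- The rankings that the algorithm finds are good enough. -/
theorem Valid.best_spec (hI : I.Valid) :
    ∃ (π : Fin m → Equiv.Perm (Fin n)) (t : Fin m → Fin (n - 1)) (v : ℝ),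
      I.best hI.two_le = some (v, List.ofFn fun i => List.ofFn (π i)) ∧
      I.coStar I.w ≤ I.co (fun i => raise (I.w i) (t i)) π := by
  have hn := hI.two_le
  -- Any target point shows that there is at least one sample, so the best candidate exists.
  obtain ⟨x₀, hx₀, -⟩ := exists_mem_samples 3 (collectAffs (I.stackList hn)) (point 0 0)
  obtain ⟨c, h1, h2, h3, -⟩ := foldl_better
    ((samples 3 (collectAffs (I.stackList hn))).map fun x => I.evaluate (candidate (I.stackList hn) x))
    none (.inl (by simpa using List.ne_nil_of_mem hx₀))
  simp only [reduceCtorEq, or_false, List.mem_map] at h2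
  obtain ⟨x, hx, rfl⟩ := h2
  obtain ⟨π, t, hπ⟩ := exists_rankings (I := I) hn x
  refine ⟨π, t, (I.evaluate (candidate (I.stackList hn) x)).1, ?_, ?_⟩
  · rw [best, ← List.foldl_map, h1, hπ]
  · refine Finset.sup'_le _ _ fun σ _ => ?_
    have h4 := hI.le_of_sample hn (fun y hy => h3 _ (List.mem_map_of_mem hy)) σ
    rw [hπ] at h4
    exact h4

end Instance

open Prog (hd tl bin var none zero)

/-- A list of encoded elements. -/
def listOf {α : Type*} (f : α → Data) (l : List α) : Data := .ofList (l.map f)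

@[simp]
theorem listOf_nil {α : Type*} (f : α → Data) : listOf f [] = .nil := rfl

@[simp]
theorem listOf_cons {α : Type*} (f : α → Data) (a : α) (l : List α) :
    listOf f (a :: l) = .pair (f a) (listOf f l) := rfl

/-! ### Programs for lists -/

section ListPrograms

variable {O : Oracle} {s : ℕ} {α : Type*} {f : α → Data}

/-- Put the reversal of a list in front of another list. -/
noncomputable def reverseCode : Code :=
  .fold .X (.straight (var 0)) (.straight (var 1)) (.straight (.pair (var 0) (var 1)))

theorem comp_reverse {l r : List α} (hl : l.length ≤ s) (Z : Data) :
    Comp O s reverseCode (.pair (listOf f l) (.pair (listOf f r) Z)) (listOf f (l.reverse ++ r)) := by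
  have h : l.foldl (fun acc a => a :: acc) r = l.reverse ++ r := by
    simp
  rw [← h]
  refine Comp.fold f (listOf f) (fun acc a => a :: acc) (.straight (by simp) rfl)
    (by simpa using hl) (.straight (by simp) rfl) fun b a _ => ?_
  exact .straight (by simp [Prog.Straight]) rfl

/-- The encoding of a swap. -/
def swapData (f : α → Data) (σ : Swap α) : Data :=
  .pair (listOf f σ.pre) (listOf f (σ.fst :: σ.snd :: σ.post))

/-- The encoding of an optional element. -/
def optionData {β : Type*} (f : β → Data) : Option β → Data
  | .none => .nil
  | .some b => f b

/-- The time of the swap of the first two elements of a list, with programs for the coordinates of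
elements. -/
abbrev timeProg (kx ky r : Prog) : Prog :=
  bin .div (bin .sub (.seq (hd r) kx) (.seq (hd (tl r)) kx))
    (bin .sub (.seq (hd (tl r)) ky) (.seq (hd r) ky))

/-- A step in the search for the earliest swap. -/
abbrev scanProg (kx ky : Prog) : Prog :=
  .ite (tl (hd (tl (var 1))))
    (.pair (.pair (hd (hd (tl (var 1)))) (hd (var 1)))
      (.pair (tl (hd (tl (var 1))))
        (.ite (bin .lt (.seq (hd (hd (tl (var 1)))) ky) (.seq (hd (tl (hd (tl (var 1))))) ky))
          (.ite (tl (tl (var 1)))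
            (.ite (bin .lt (timeProg kx ky (hd (tl (var 1)))) (timeProg kx ky (tl (tl (tl (var 1))))))
              (.pair (hd (var 1)) (hd (tl (var 1))))
              (tl (tl (var 1))))
            (.pair (hd (var 1)) (hd (tl (var 1)))))
          (tl (tl (var 1))))))
    (var 1)

/-- The earliest swap. -/
noncomputable def scanCode (kx ky : Prog) : Code :=
  (Code.fold .X (.straight (var 0)) (.straight (.pair none (.pair (var 0) none)))
    (.straight (scanProg kx ky))).seq (.straight (tl (.op .snd)))

variable {x y : α → ℝ} {kx ky : Prog}

/-- The program `k` computes the number `x a` from the encoding of `a`. -/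
structure Computes (O : Oracle) (f : α → Data) (k : Prog) (x : α → ℝ) : Prop where
  straight : k.Straight
  val : ∀ a, k.val O (f a) = .num (x a)

theorem comp_scan (hx : Computes O f kx x) (hy : Computes O f ky y) {l : List α}
    (hl : l.length ≤ s) (Z : Data) :
    Comp O s (scanCode kx ky) (.pair (listOf f l) Z) (optionData (swapData f) (scan x y l)) := by
  let g : List α × List α × Option (Swap α) → Data := fun st =>
    .pair (listOf f st.1) (.pair (listOf f st.2.1) (optionData (swapData f) st.2.2))
  refine Comp.seq (y := g (l.foldl (fun st _ => scanStep x y st) ([], l, .none))) ?_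
    (.straight (by simp [Prog.Straight]) rfl)
  refine Comp.fold f g (fun st _ => scanStep x y st) (.straight (by simp) rfl)
    (by simpa using hl) (.straight (by simp [Prog.Straight]) rfl) fun st a _ => ?_
  refine .straight (by simp [Prog.Straight, hx.straight, hy.straight]) ?_
  rcases st with ⟨p, _ | ⟨u, _ | ⟨v, t⟩⟩, best⟩
  · simp [g, Prog.val, Op.eval, scanStep]
  · simp [g, Prog.val, Op.eval, scanStep]
  · rcases best with _ | ρ
    · by_cases h : y u < y v <;>
        simp [g, Prog.val, Op.eval, scanStep, improve, hy.val, optionData, swapData, h]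
    · by_cases h : y u < y v
      · by_cases h' : Swap.time x y ⟨p, u, v, t⟩ < ρ.time x y
        · have h'' := h'
          simp only [Swap.time] at h''
          simp [g, Prog.val, Op.eval, scanStep, improve, hx.val, hy.val, optionData, swapData, h, h',
            h'']
        · have h'' := h'
          simp only [Swap.time] at h''
          simp [g, Prog.val, Op.eval, scanStep, improve, hx.val, hy.val, optionData, swapData, h, h',
            h'']
      · simp [g, Prog.val, Op.eval, scanStep, improve, hy.val, optionData, swapData, h]

/-- From a swap, the list after it. -/
noncomputable def afterCode : Code :=
  (Code.straight (.pair (var 0) (.pair (.pair (hd (tl (.op .snd))) (.pair (hd (.op .snd))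
    (tl (tl (.op .snd))))) none))).seq reverseCode

theorem comp_after {σ : Swap α} (hσ : σ.before.length ≤ s) :
    Comp O s afterCode (swapData f σ) (listOf f σ.after) := by
  have := σ.length_before
  refine .seq (.straight (by simp [Prog.Straight]) ?_)
    (comp_reverse (f := f) (l := σ.pre) (r := σ.snd :: σ.fst :: σ.post) (by omega) .nil)
  simp [Prog.val, Op.eval, swapData]

/-- Perform the earliest swap. -/
noncomputable def swapStepCode (kx ky : Prog) : Code :=
  (scanCode kx ky).bind (.ite (var 0) ((Code.straight (var 0)).seq afterCode) (.straight (var 1)))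

theorem scan_before {l : List α} {σ : Swap α} (h : scan x y l = some σ) : σ.before = l := by
  have := scan_spec (x := x) (y := y) l
  rw [h] at this
  exact this.1

theorem comp_swapStep (hx : Computes O f kx x) (hy : Computes O f ky y) {l : List α}
    (hl : l.length ≤ s) (Z : Data) :
    Comp O s (swapStepCode kx ky) (.pair (listOf f l) Z) (listOf f (swapStep x y l)) := by
  refine (comp_scan hx hy hl Z).bind ?_
  unfold swapStep
  rcases h : scan x y l with _ | σ
  · exact .ite_false (by simp) rfl (.straight (by simp) rfl)
  · exact .ite_true (by simp) (by simp [optionData, swapData])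
      (.seq (.straight (by simp) rfl) (comp_after (by rwa [scan_before h])))

/-- Sort a list by repeated swaps; the number of rounds is the square of the length of a further
list. -/
noncomputable def sortCode (kx ky : Prog) : Code :=
  .fold .X (.straight (var 1)) (.straight (var 0))
    (.fold .X (.straight (var 3)) (.straight (var 1))
      ((Code.straight (.op .snd)).seq (swapStepCode kx ky)))

/-- Two nested folds over a list of length `n` serve as a counter for `n * n` iterations. -/
theorem foldl_foldl_const {β γ : Type*} (F : β → β) (W : List γ) (b : β) :
    W.foldl (fun b _ => W.foldl (fun b _ => F b) b) b = F^[W.length * W.length] b := by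
  simp only [foldl_const]
  rw [Function.iterate_mul]

theorem comp_sort {γ : Type*} {fw : γ → Data} (hx : Computes O f kx x) (hy : Computes O f ky y)
    {l : List α} {W : List γ} (hl : l.length ≤ s) (hW : W.length ≤ s) (Z : Data) :
    Comp O s (sortCode kx ky) (.pair (listOf f l) (.pair (listOf fw W) Z))
      (listOf f ((swapStep x y)^[W.length * W.length] l)) := by
  rw [← foldl_foldl_const]
  have hlen : ∀ l : List α, (swapStep x y l).length = l.length := fun l =>
    (swapStep_perm l).length_eq
  -- The length of the current list has to be an invariant, since the inner step bound depends on
  -- it.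
  refine Comp.fold_inv fw (listOf f) (fun b _ => W.foldl (fun b _ => swapStep x y b) b)
    (fun b => b.length ≤ s) (.straight (by simp) rfl) (by simpa using hW)
    (.straight (by simp) rfl) hl fun b a _ hb => ⟨?_, ?_⟩
  · rwa [foldl_const, (iterate_swapStep_perm _ _).length_eq]
  · refine Comp.fold_inv fw (listOf f) (fun b _ => swapStep x y b)
      (fun b => b.length ≤ s) (.straight (by simp) rfl) (by simpa using hW)
      (.straight (by simp) rfl) hb fun b a _ hb => ⟨(hlen b).trans_le hb, ?_⟩
    exact .seq (.straight (p := .op .snd) trivial rfl) (comp_swapStep hx hy hb _)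

end ListPrograms

/-! ### Programs for affine functions -/

section AffPrograms

variable {O : Oracle} {s : ℕ}

/-- The encoding of an affine function. -/
def affData : ∀ {d : ℕ}, Aff d → Data
  | _, .const c => .num c
  | _, .cons b l => .pair (.num b) (affData l)

/-- The encoding of a point. -/
def ptData : ∀ {d : ℕ}, Pt d → Data
  | _, .nil => .nil
  | _, .cons z x => .pair (.num z) (ptData x)

/-- The value of an affine function at a point. -/
def evalProg : ℕ → Prog
  | 0 => .op .fst
  | d + 1 => bin .add (bin .mul (hd (.op .fst)) (hd (.op .snd)))
      (.seq (.pair (tl (.op .fst)) (tl (.op .snd))) (evalProg d))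

@[simp]
theorem straight_evalProg : ∀ d, (evalProg d).Straight
  | 0 => trivial
  | d + 1 => by simp [evalProg, Prog.Straight, straight_evalProg d]

@[simp]
theorem val_evalProg : ∀ {d : ℕ} (l : Aff d) (x : Pt d),
    (evalProg d).val O (.pair (affData l) (ptData x)) = .num (l.eval x)
  | _, .const _, .nil => rfl
  | _, .cons _ l, .cons _ x => by
    simp [evalProg, Prog.val, Op.eval, affData, ptData, val_evalProg l x, Aff.eval]

/-- The difference of multiples of two affine functions. -/
def combineProg : ℕ → Prog
  | 0 => bin .sub (bin .mul (hd (.op .fst)) (hd (.op .snd)))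
      (bin .mul (tl (.op .fst)) (tl (.op .snd)))
  | d + 1 => .pair
      (bin .sub (bin .mul (hd (.op .fst)) (hd (hd (.op .snd))))
        (bin .mul (tl (.op .fst)) (hd (tl (.op .snd)))))
      (.seq (.pair (.op .fst) (.pair (tl (hd (.op .snd))) (tl (tl (.op .snd))))) (combineProg d))

@[simp]
theorem straight_combineProg : ∀ d, (combineProg d).Straight
  | 0 => by simp [combineProg, Prog.Straight]
  | d + 1 => by simp [combineProg, Prog.Straight, straight_combineProg d]

@[simp]
theorem val_combineProg (r t : ℝ) : ∀ {d : ℕ} (k l : Aff d),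
    (combineProg d).val O (.pair (.pair (.num r) (.num t)) (.pair (affData k) (affData l)))
      = affData (Aff.combine r t k l)
  | _, .const _, .const _ => rfl
  | _, .cons _ k, .cons _ l => by
    simp [combineProg, Prog.val, Op.eval, affData, val_combineProg r t k l, Aff.combine]

/-- The zero function. -/
def zeroProg : ℕ → Prog
  | 0 => zero
  | d + 1 => .pair zero (zeroProg d)

@[simp]
theorem straight_zeroProg : ∀ d, (zeroProg d).Straight
  | 0 => by simp [zeroProg, Prog.Straight]
  | d + 1 => by simp [zeroProg, Prog.Straight, straight_zeroProg d]

@[simp]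
theorem val_zeroProg (X : Data) : ∀ d, (zeroProg d).val O X = affData (Aff.zero d)
  | 0 => by simp [zeroProg, Prog.val, Op.eval, affData, Aff.zero]
  | d + 1 => by simp [zeroProg, Prog.val, Op.eval, affData, Aff.zero, val_zeroProg X d]

theorem affData_succ {d : ℕ} (k : Aff (d + 1)) :
    affData k = .pair (.num k.coeff) (affData k.rest) := by
  cases k
  rfl

/-- All eliminations of the first variable from pairs of affine functions. -/
noncomputable def elimsCode (d : ℕ) (len : Polynomial ℕ) : Code :=
  .fold len (.straight (var 0)) (.straight none)
    (.fold len (.straight (var 2)) (.straight (var 1))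
      (.straight (.pair
        (.seq (.pair (.pair (hd (var 0)) (hd (var 2))) (.pair (tl (var 2)) (tl (var 0))))
          (combineProg d))
        (var 1))))

theorem comp_elims {d : ℕ} {len : Polynomial ℕ} {L : List (Aff (d + 1))}
    (hL : L.length ≤ len.eval s) (Z : Data) :
    Comp O s (elimsCode d len) (.pair (listOf affData L) Z) (listOf affData (Aff.elims L)) := by
  refine Comp.fold affData (listOf affData) _ (.straight (by simp) rfl) hL
    (.straight (by simp [Prog.Straight]) rfl) fun acc k _ => ?_
  refine Comp.fold affData (listOf affData) (fun acc l => Aff.elim k l :: acc)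
    (.straight (by simp) rfl) hL (.straight (by simp) rfl) fun acc l _ => ?_
  refine .straight (by simp [Prog.Straight]) ?_
  simp [Prog.val, Op.eval, affData_succ k, affData_succ l, Aff.elim]

/-- All roots of affine functions over a point. -/
noncomputable def rootsCode (d : ℕ) (len : Polynomial ℕ) : Code :=
  .fold len (.straight (var 1)) (.straight none)
    (.straight (.pair
      (bin .div (bin .sub zero (.seq (.pair (tl (var 0)) (var 2)) (evalProg d))) (hd (var 0)))
      (var 1)))

theorem comp_roots {d : ℕ} {len : Polynomial ℕ} {L : List (Aff (d + 1))}
    (hL : L.length ≤ len.eval s) (x : Pt d) (Z : Data) :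
    Comp O s (rootsCode d len) (.pair (ptData x) (.pair (listOf affData L) Z))
      (listOf .num (Aff.roots x L)) := by
  refine Comp.fold affData (listOf .num) (fun acc k => Aff.root x k :: acc)
    (.straight (by simp) rfl) hL (.straight (by simp [Prog.Straight]) rfl) fun acc k _ => ?_
  refine .straight (by simp [Prog.Straight]) ?_
  simp [Prog.val, Op.eval, affData_succ k, Aff.root]

/-- The mean of two numbers. -/
abbrev meanProg (p q : Prog) : Prog := bin .div (bin .add p q) (bin .add (.op .one) (.op .one))

/-- Add all points over a point whose first coordinates are shifted means. -/
noncomputable def liftsCode (len : Polynomial ℕ) : Code :=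
  .fold len (.straight (var 0)) (.straight (var 2))
    (.fold len (.straight (var 2)) (.straight (var 1))
      (.straight (.pair (.pair (meanProg (var 2) (var 0)) (var 5))
        (.pair (.pair (bin .add (meanProg (var 2) (var 0)) (.op .one)) (var 5))
          (.pair (.pair (bin .sub (meanProg (var 2) (var 0)) (.op .one)) (var 5)) (var 1))))))

theorem comp_lifts {d : ℕ} {len : Polynomial ℕ} {R : List ℝ} (hR : R.length ≤ len.eval s)
    (x : Pt d) (acc : List (Pt (d + 1))) (Z : Data) :
    Comp O s (liftsCode len)
      (.pair (listOf .num R) (.pair (ptData x) (.pair (listOf ptData acc) Z)))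
      (listOf ptData (Pt.lifts x R acc)) := by
  refine Comp.fold .num (listOf ptData) _ (.straight (by simp) rfl) hR
    (.straight (by simp) rfl) fun acc r _ => ?_
  refine Comp.fold .num (listOf ptData) (fun acc r' => Pt.cons ((r + r') / 2) x ::
    Pt.cons ((r + r') / 2 + 1) x :: Pt.cons ((r + r') / 2 - 1) x :: acc)
    (.straight (by simp) rfl) hR (.straight (by simp) rfl) fun acc r' _ => ?_
  refine .straight (by simp [Prog.Straight]) ?_
  simp [Prog.val, Op.eval, ptData, one_add_one_eq_two]

/-- A bound on the number of sample points. -/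
noncomputable def samplesLength : ℕ → Polynomial ℕ → Polynomial ℕ
  | 0, _ => 1
  | d + 1, len => samplesLength d ((len + 1) * (len + 1)) * ((len + 1) * ((len + 1) * 3))

/-- Every eliminated variable squares the number of functions, which stays polynomial because the
dimension is fixed. -/
theorem length_samples_le : ∀ {d : ℕ} {len : Polynomial ℕ} {L : List (Aff d)},
    L.length ≤ len.eval s → (samples d L).length ≤ (samplesLength d len).eval s
  | 0, len, L, _ => by simp [samples, samplesLength]
  | d + 1, len, L, h => by
    have h1 : L.length + 1 ≤ (len + 1).eval s := by simpa using h
    have h2 : (Aff.elims (Aff.first d :: L)).length ≤ ((len + 1) * (len + 1)).eval s := by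
      rw [Aff.length_elims, Polynomial.eval_mul, List.length_cons]
      exact Nat.mul_le_mul h1 h1
    rw [length_samples_succ, samplesLength, Polynomial.eval_mul, Polynomial.eval_mul,
      Polynomial.eval_mul, Polynomial.eval_ofNat]
    exact Nat.mul_le_mul (length_samples_le h2)
      (Nat.mul_le_mul h1 (Nat.mul_le_mul_right 3 h1))

/-- All sample points. -/
noncomputable def samplesCode : ℕ → Polynomial ℕ → Code
  | 0, _ => .straight (.pair none none)
  | d + 1, len =>
    (Code.straight (.pair (.pair (.op .one) (zeroProg d)) (var 0))).bind <|
    (elimsCode d (len + 1)).bind <|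
    (samplesCode d ((len + 1) * (len + 1))).bind <|
    .fold (samplesLength d ((len + 1) * (len + 1))) (.straight (var 0)) (.straight none) <|
    ((Code.straight (.pair (var 0) (.pair (var 4) none))).seq (rootsCode d (len + 1))).bind
      (liftsCode (len + 1))

theorem comp_samples : ∀ {d : ℕ} {len : Polynomial ℕ} {L : List (Aff d)},
    L.length ≤ len.eval s → ∀ Z : Data,
    Comp O s (samplesCode d len) (.pair (listOf affData L) Z) (listOf ptData (samples d L))
  | 0, len, L, _, Z => .straight (by simp [Prog.Straight]) rfl
  | d + 1, len, L, h, Z => by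
    have h1 : (Aff.first d :: L).length ≤ (len + 1).eval s := by simpa using h
    have h2 : (Aff.elims (Aff.first d :: L)).length ≤ ((len + 1) * (len + 1)).eval s := by
      rw [Aff.length_elims, Polynomial.eval_mul]
      exact Nat.mul_le_mul h1 h1
    refine .bind (.straight (y := listOf affData (Aff.first d :: L)) (by simp [Prog.Straight]) ?_) ?_
    · simp [Prog.val, Op.eval, Aff.first, affData]
    refine .bind (comp_elims h1 _) (.bind (comp_samples h2 _) ?_)
    refine Comp.fold ptData (listOf ptData)
      (fun acc x => Pt.lifts x (Aff.roots x (Aff.first d :: L)) acc) (.straight (by simp) rfl)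
      (length_samples_le h2) (.straight (by simp [Prog.Straight]) rfl) fun acc x _ => ?_
    refine .bind (.seq (.straight (by simp [Prog.Straight]) rfl) (comp_roots h1 x .nil)) ?_
    exact comp_lifts (by rwa [Aff.length_roots]) x acc _

end AffPrograms

/-! ### Programs for a single instance -/

namespace Instance

variable {m n : ℕ} (I : Instance m n)

/-- The input for a result. -/
def triple (i : Fin m) (j : Fin n) : Data :=
  .pair (.num (I.a i j)) (.pair (.num (I.b i j)) (.num (I.w i j)))

/-- The encoding of a result by its scores and its number. -/
def item (i : Fin m) (j : Fin n) : Data :=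
  .pair (.num (I.a i j)) (.pair (.num (I.b i j)) (.numeral j))

/-- The list of the inputs for the results of an instance. -/
def weights (i : Fin m) : Data := listOf (I.triple i) (List.finRange n)

end Instance

/-- The encoding of a ranking. -/
def orderData {n : ℕ} (l : List (Fin n)) : Data := listOf (fun j : Fin n => .numeral j) l

/-- The encoding of the data of a swap. -/
def linkData {n : ℕ} (k : Link n) : Data :=
  .pair (affData k.aff) (.pair (.num k.fst) (.pair (.num k.snd) (.pair (.num k.val)
    (orderData k.order))))

/-- The two scores of a list. -/
noncomputable def scoreCode : Code :=
  (Code.fold .X (.straight (var 0)) (.straight (.pair (var 1) (.pair zero zero)))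
    (.straight (.ite (hd (var 1))
      (.pair (tl (hd (var 1)))
        (.pair
          (bin .add (hd (tl (var 1))) (bin .mul (tl (tl (hd (hd (var 1))))) (hd (var 0))))
          (bin .add (tl (tl (var 1))) (bin .mul (tl (tl (hd (hd (var 1))))) (hd (tl (var 0)))))))
      (var 1)))).seq (.straight (.op .snd))

/-- Remove as many elements from one list as another one has. -/
noncomputable def dropCode : Code :=
  .fold .X (.straight (var 0)) (.straight (var 1)) (.straight (tl (var 1)))

/-- The ranking that belongs to a list of results. -/
noncomputable def orderCode : Code :=
  ((Code.straight (.pair (var 0) (.pair none none))).seq reverseCode).bind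
    (.fold .X (.straight (var 0)) (.straight none)
      (.straight (.pair (tl (tl (var 0))) (var 1))))

theorem numeral_succ (k : ℕ) : Data.numeral (k + 1) = .pair .nil (.numeral k) := rfl

theorem length_numeral (k : ℕ) : (Data.numeral k).length = k := by
  induction k with
  | zero => rfl
  | succ k ih => rw [numeral_succ, Data.length, ih]

section

variable {O : Oracle} {s m n : ℕ} {I : Instance m n} {i : Fin m}

theorem comp_score {l : List (Fin n)} (hl : l.length ≤ s) (Z : Data) :
    Comp O s scoreCode (.pair (listOf (I.item i) l) (.pair (I.weights i) Z))
      (.pair (.num (listScore (I.w i) (I.a i) l)) (.num (listScore (I.w i) (I.b i) l))) := by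
  -- The weights are consumed alongside the ranking; once they are exhausted nothing changes, in
  -- agreement with the truncation of `List.zipWith`.
  let step : List (Fin n) × ℝ × ℝ → Fin n → List (Fin n) × ℝ × ℝ := fun st j =>
    match st with
    | ([], c) => ([], c)
    | (k :: W, c) => (W, c.1 + I.w i k * I.a i j, c.2 + I.w i k * I.b i j)
  let g : List (Fin n) × ℝ × ℝ → Data := fun st =>
    .pair (listOf (I.triple i) st.1) (.pair (.num st.2.1) (.num st.2.2))
  have key : ∀ (l W : List (Fin n)) (c : ℝ × ℝ), (l.foldl step (W, c)).2 =
      (c.1 + (List.zipWith (fun k j => I.w i k * I.a i j) W l).sum,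
        c.2 + (List.zipWith (fun k j => I.w i k * I.b i j) W l).sum) := by
    intro l
    induction l with
    | nil => simp
    | cons j l ih =>
      rintro (_ | ⟨k, W⟩) c
      · simpa [step] using ih [] c
      · simp [step, ih, add_assoc]
  have hfinal := key l (List.finRange n) (0, 0)
  simp only [zero_add] at hfinal
  refine Comp.seq (y := g (l.foldl step (List.finRange n, 0, 0))) ?_ (.straight
    (by simp [Prog.Straight]) ?_)
  · refine Comp.fold (I.item i) g step (.straight (by simp) rfl) (by simpa using hl)
      (.straight (by simp [Prog.Straight]) ?_) fun st j _ => .straight (by simp [Prog.Straight]) ?_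
    · simp [Prog.val, Op.eval, g, Instance.weights]
    · rcases st with ⟨_ | ⟨k, W⟩, c⟩ <;>
        simp [Prog.val, Op.eval, g, step, Instance.triple, Instance.item]
  · simp [Prog.val, Op.eval, g, hfinal, listScore]

theorem comp_drop {α β : Type*} {f : α → Data} {f' : β → Data} {l : List α} (hl : l.length ≤ s)
    (W : List β) (Z : Data) :
    Comp O s dropCode (.pair (listOf f l) (.pair (listOf f' W) Z)) (listOf f' (W.drop l.length)) := by
  have h : l.foldl (fun (W : List β) _ => W.tail) W = W.drop l.length := by
    induction l generalizing W with
    | nil => rfl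
    | cons a l ih =>
      rw [List.foldl_cons, ih (by simp at hl; omega)]
      simp
  rw [← h]
  refine Comp.fold f (listOf f') (fun W _ => W.tail) (.straight (by simp) rfl)
    (by simpa using hl) (.straight (by simp) rfl) fun W a _ => ?_
  refine .straight (by simp [Prog.Straight]) ?_
  rcases W with _ | ⟨b, W⟩ <;> simp [Prog.val, Op.eval]

theorem comp_order {l : List (Fin n)} (hl : l.length ≤ s) (Z : Data) :
    Comp O s orderCode (.pair (listOf (I.item i) l) Z) (orderData l) := by
  refine .bind (y := listOf (I.item i) l.reverse) (.seq (.straight (by simp [Prog.Straight]) rfl) ?_) ?_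
  · have := comp_reverse (O := O) (f := I.item i) (r := []) hl .nil
    rwa [List.append_nil] at this
  · have h : l.reverse.foldl (fun acc j => j :: acc) [] = l := by simp
    have := Comp.fold (O := O) (s := s) (len := .X) (list := .straight (var 0))
      (init := .straight none) (body := .straight (.pair (tl (tl (var 0))) (var 1)))
      (env := .pair (listOf (I.item i) l.reverse) (.pair (listOf (I.item i) l) Z))
      (I.item i) orderData (fun acc j => j :: acc) (l := l.reverse) (b := [])
      (.straight (by simp) rfl) (by simpa using hl) (.straight (by simp [Prog.Straight]) rfl)
      fun acc j _ => .straight (by simp [Prog.Straight]) rfl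
    rwa [h] at this

/-- The data of a swap, from the swap, the number of the instance and its input. -/
noncomputable def linkCode : Code :=
  ((Code.straight (.pair (var 0) (.pair (var 3) none))).seq dropCode).bind <|
  ((Code.straight (.op .snd)).seq reverseCode).bind <|
  ((Code.straight (.pair (var 0) (.pair (var 5) none))).seq scoreCode).bind <|
  ((Code.straight (.pair (var 3) (var 4))).seq afterCode).bind <|
  ((Code.straight (.pair (var 0) (.pair (var 7) none))).seq scoreCode).bind <|
  ((Code.straight (.pair (var 3) none)).seq orderCode).bind <|
  (Code.straight (tl (bin .query (var 8) (var 1)))).bind <|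
  (Code.straight (.pair
    (bin .add (hd (var 4)) (bin .mul
      (bin .sub (tl (tl (hd (var 6)))) (tl (tl (hd (tl (var 6)))))) (hd (hd (tl (var 8))))))
    (bin .add (tl (var 4)) (bin .mul
      (bin .sub (tl (tl (hd (var 6)))) (tl (tl (hd (tl (var 6)))))) (hd (tl (hd (tl (var 8))))))))).bind <|
  (Code.straight (.pair
    (bin .sub (hd (hd (tl (var 9)))) (hd (hd (var 9))))
    (bin .sub (hd (tl (hd (tl (var 9))))) (hd (tl (hd (var 9))))))).bind <|
  .straight (.pair
    (.pair (hd (var 0)) (.pair (tl (var 0)) (.pair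
      (bin .add (bin .div (hd (var 0)) (bin .add (.op .one) (hd (var 4))))
        (bin .div (tl (var 0)) (bin .add (.op .one) (tl (var 4)))))
      (bin .add (bin .mul (hd (var 2)) (hd (var 0))) (bin .mul (tl (var 2)) (tl (var 0)))))))
    (.pair (hd (var 1)) (.pair (tl (var 1)) (.pair (hd (bin .query (var 11) (var 1))) (var 3)))))

theorem comp_link {σ : Swap (Fin n)} (hσ : σ.before.length = n) (hn : n ≤ s) (Z : Data) :
    Comp I.oracle s linkCode
      (.pair (listOf (I.item i) σ.pre) (.pair (listOf (I.item i) (σ.fst :: σ.snd :: σ.post))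
        (.pair (.numeral (i + 1)) (.pair (I.weights i) Z))))
      (linkData (I.link i σ)) := by
  have hlen := σ.length_before
  have ht : σ.pre.length + 1 < n := by omega
  refine .bind (.seq (.straight (by simp [Prog.Straight]) rfl)
    (comp_drop (f := I.item i) (f' := I.triple i) (l := σ.pre) (by omega) (List.finRange n) .nil)) ?_
  refine .bind (.seq (.straight (p := .op .snd) trivial rfl)
    (comp_reverse (f := I.item i) (l := σ.pre) (r := σ.fst :: σ.snd :: σ.post) (by omega) _)) ?_
  refine .bind (.seq (.straight (by simp [Prog.Straight]) rfl)
    (comp_score (I := I) (i := i) (l := σ.before) (by omega) .nil)) ?_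
  refine .bind (.seq (.straight (y := swapData (I.item i) σ) (by simp [Prog.Straight]) rfl)
    (comp_after (by omega))) ?_
  refine .bind (.seq (.straight (by simp [Prog.Straight]) rfl)
    (comp_score (I := I) (i := i) (l := σ.after) (by have := σ.after_perm.length_eq; omega) .nil)) ?_
  refine .bind (.seq (.straight (by simp [Prog.Straight]) rfl)
    (comp_order (I := I) (i := i) (l := σ.before) (by omega) .nil)) ?_
  refine .bind (.straight (y := .pair
    (.num (I.gradf i (listScores (I.w i) (I.a i) (I.b i) σ.after)).1)
    (.num (I.gradf i (listScores (I.w i) (I.a i) (I.b i) σ.after)).2)) (by simp [Prog.Straight]) ?_) ?_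
  · simp [Prog.val, Op.eval, length_numeral, Instance.oracle, answer, listScores]
  refine .bind (.straight (y := .pair (.num (raisedScore (I.w i) (I.a i) σ))
    (.num (raisedScore (I.w i) (I.b i) σ))) (by simp [Prog.Straight]) ?_) ?_
  -- Dropping as many weights as there are elements in front of the swap leaves the two relevant
  -- weights at the head.
  · simp [Prog.val, Op.eval, raisedScore, gap, drop_finRange ht,
      drop_finRange (show σ.pre.length < n by omega), ht, Instance.triple, Instance.item]
  refine .bind (.straight (y := .pair (.num (I.a i σ.snd - I.a i σ.fst))
    (.num (I.b i σ.snd - I.b i σ.fst))) (by simp [Prog.Straight]) ?_) ?_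
  · simp [Prog.val, Op.eval, Instance.item]
  refine .straight (by simp [Prog.Straight]) ?_
  simp [Prog.val, Op.eval, length_numeral, Instance.oracle, answer, linkData, Instance.link,
    Instance.affOf, affData]

/-- Perform the earliest swap and record its data. -/
noncomputable def chainStepCode : Code :=
  ((Code.straight (.pair (hd (var 0)) none)).seq
    (scanCode (.op .fst) (hd (.op .snd)))).bind <|
  .ite (var 0)
    (((Code.straight (var 0)).seq afterCode).pair
      (((Code.straight (.pair (hd (var 0)) (.pair (tl (var 0)) (tl (.op .snd))))).seq linkCode).pair
        (.straight (tl (var 1)))))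
    (.straight (var 1))

/-- The encoding of a list and a sequence of swaps. -/
noncomputable def chainData (I : Instance m n) (i : Fin m) (c : List (Fin n) × List (Swap (Fin n))) :
    Data :=
  .pair (listOf (I.item i) c.1) (listOf linkData (c.2.map (I.link i)))

theorem computes_fst : Computes O (I.item i) (.op .fst) (I.a i) := ⟨trivial, fun _ => rfl⟩

theorem computes_snd : Computes O (I.item i) (hd (.op .snd)) (I.b i) :=
  ⟨by simp [Prog.Straight], fun _ => rfl⟩

theorem computes_zero : Computes O (I.item i) zero fun _ => 0 :=
  ⟨by simp [Prog.Straight], fun _ => by simp [Prog.val, Op.eval]⟩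

theorem comp_chainStep {c : List (Fin n) × List (Swap (Fin n))} (hc : c.1.length = n) (hn : n ≤ s)
    (Z : Data) :
    Comp I.oracle s chainStepCode
      (.pair (chainData I i c) (.pair (.numeral (i + 1)) (.pair (I.weights i) Z)))
      (chainData I i (chainStep (I.a i) (I.b i) c)) := by
  refine .bind (.seq (.straight (by simp [Prog.Straight]) rfl)
    (comp_scan computes_fst computes_snd (l := c.1) (by omega) .nil)) ?_
  unfold chainStep
  rcases h : scan (I.a i) (I.b i) c.1 with _ | σ
  · exact .ite_false (by simp) rfl (.straight (by simp) rfl)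
  · have hσ : σ.before.length = n := by rw [scan_before h, hc]
    refine .ite_true (by simp) (by simp [optionData, swapData]) ?_
    refine .pair (.seq (.straight (by simp) rfl) (comp_after (by omega))) ?_
    refine .pair (.seq (.straight (by simp [Prog.Straight]) rfl) (comp_link hσ hn Z)) ?_
    exact .straight (by simp [Prog.Straight]) rfl

/-- The data for the final list and all swaps of an instance, from the number of the instance and
its input. -/
noncomputable def stackCode : Code :=
  ((Code.fold .X (.straight (var 1)) (.straight (.pair none none))
    (.straight (.pair (.pair none (hd (var 1)))
      (.pair (.pair (hd (var 0)) (.pair (hd (tl (var 0))) (hd (var 1)))) (tl (var 1)))))).seq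
    (.straight (.op .snd))).bind <|
  ((Code.straight (.pair (var 0) (.pair (var 2) none))).seq (sortCode zero (.op .fst))).bind <|
  (Code.fold .X (.straight (var 3)) (.straight (.pair (var 0) none))
    (.fold .X (.straight (var 5)) (.straight (var 1))
      ((Code.straight (.pair (var 1) (tl (tl (tl (tl (tl (.op .snd)))))))).seq
        chainStepCode))).bind <|
  ((Code.straight (.pair none (.pair (hd (var 0)) (tl (tl (tl (.op .id))))))).seq linkCode).pair
    (.straight (tl (var 0)))

/-- The encoding of the data of an instance. -/
def stackData (k : Link n × List (Link n)) : Data := .pair (linkData k.1) (listOf linkData k.2)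

theorem comp_stack (hn : 2 ≤ n) (hs : n ≤ s) (Z : Data) :
    Comp I.oracle s stackCode (.pair (.numeral (i + 1)) (.pair (I.weights i) Z))
      (stackData (I.stack hn i)) := by
  have hW : (List.finRange n).length ≤ (Polynomial.X : Polynomial ℕ).eval s := by simpa using hs
  refine .bind (y := listOf (I.item i) (List.finRange n).reverse) (.seq (y := .pair
    (.numeral (List.finRange n).length) (listOf (I.item i) (List.finRange n).reverse)) ?_
    (.straight (by simp [Prog.Straight]) rfl)) ?_
  -- The items are numbered by the length of the prefix read so far, so the fold is described by
  -- prefixes and not by a step function.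
  · refine Comp.fold_prefix (I.triple i) (fun l₁ => .pair (.numeral l₁.length)
      (listOf (I.item i) l₁.reverse)) (.straight (by simp) rfl) hW
      (.straight (by simp [Prog.Straight]) rfl) fun l₁ j l₂ h => .straight (by simp [Prog.Straight]) ?_
    have hj : l₁.length = j := by
      have h1 : (List.finRange n)[l₁.length]? = some j := by simp [h]
      obtain ⟨h2, h3⟩ := List.getElem?_eq_some_iff.1 h1
      rw [← h3]
      simp
    simp [Prog.val, Op.eval, Instance.triple, Instance.item, numeral_succ, hj]
  refine .bind (.seq (.straight (by simp [Prog.Straight]) rfl) (comp_sort computes_zero computes_fst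
    (fw := I.triple i) (W := List.finRange n) (by simpa using hs) (by simpa using hs) .nil)) ?_
  have hsorted : (swapStep (fun _ => 0) (I.a i))^[(List.finRange n).length *
      (List.finRange n).length] (List.finRange n).reverse = I.sorted i := by
    rw [List.length_finRange]
    rfl
  rw [hsorted]
  have hstep : ∀ c : List (Fin n) × List (Swap (Fin n)),
      (chainStep (I.a i) (I.b i) c).1.length = c.1.length := fun c =>
    (Instance.iterate_chainStep_perm 1 c).length_eq
  have hchain : (List.finRange n).foldl (fun b _ => (List.finRange n).foldl
      (fun b _ => chainStep (I.a i) (I.b i) b) b) (I.sorted i, []) = I.chain i := by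
    rw [foldl_foldl_const, List.length_finRange]
    rfl
  refine .bind (y := chainData I i (I.chain i)) ?_ ?_
  · rw [← hchain]
    refine Comp.fold_inv (I.triple i) (chainData I i) (fun b _ => (List.finRange n).foldl
      (fun b _ => chainStep (I.a i) (I.b i) b) b) (fun c => c.1.length = n)
      (.straight (by simp) rfl) hW (.straight (by simp [Prog.Straight]) rfl)
      (by simpa using (Instance.sorted_perm (I := I) i).length_eq) fun c j _ hc => ⟨?_, ?_⟩
    · rwa [foldl_const, (Instance.iterate_chainStep_perm _ _).length_eq]
    · refine Comp.fold_inv (I.triple i) (chainData I i) (fun b _ => chainStep (I.a i) (I.b i) b)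
        (fun c => c.1.length = n) (.straight (by simp) rfl) hW (.straight (by simp) rfl) hc
        fun c j _ hc => ⟨(hstep c).trans hc, ?_⟩
      exact .seq (.straight (by simp [Prog.Straight]) rfl) (comp_chainStep hc hs Z)
  · have hlen : (I.chain i).1.length = n := by
      simpa using (Instance.chain_perm (I := I) i).length_eq
    have hfirst := Instance.before_firstSwap hn hlen
    -- With nothing in front, the encoding of this swap is `nil` together with the whole final list,
    -- which is what the program supplies.
    have hpre : (Instance.firstSwap hn (I.chain i).1).pre = [] := by
      unfold Instance.firstSwap
      split <;> rfl
    have := comp_link (I := I) (i := i) (s := s) (σ := Instance.firstSwap hn (I.chain i).1)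
      (by rw [hfirst, hlen]) hs Z
    rw [hpre] at this
    rw [Swap.before, hpre] at hfirst
    rw [show _ :: _ = _ from hfirst] at this
    exact .pair (.seq (.straight (by simp [Prog.Straight]) rfl) this)
      (.straight (by simp [Prog.Straight]) rfl)

end

/-! ### The main program -/

/-- The link that is chosen at a point. -/
noncomputable def chooseCode : Code :=
  .fold (.X * .X) (.straight (tl (var 1))) (.straight (hd (var 1)))
    (.straight (.ite (bin .lt zero (.seq (.pair (hd (var 0)) (var 2)) (evalProg 3)))
      (var 1) (var 0)))

/-- The encoding of a tally. -/
def tallyData {n : ℕ} (c : Tally n) : Data :=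
  .pair (.num c.1) (.pair (.num c.2.1) (.pair (.num c.2.2.1) (listOf orderData c.2.2.2)))

/-- The tally of the links that are chosen at a point. -/
noncomputable def candidateCode : Code :=
  .fold .X (.straight (var 1)) (.straight (.pair zero (.pair zero (.pair zero none))))
    (((Code.straight (.pair (var 2) (.pair (var 0) none))).seq chooseCode).bind
      (.straight (.pair (bin .add (hd (var 2)) (hd (tl (var 0))))
        (.pair (bin .add (hd (tl (var 2))) (hd (tl (tl (var 0)))))
          (.pair (bin .add (hd (tl (tl (var 2)))) (hd (tl (tl (tl (var 0))))))
            (.pair (tl (tl (tl (tl (var 0))))) (tl (tl (tl (var 2))))))))))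

/-- The data of all instances, the last one first. -/
noncomputable def stackListCode : Code :=
  -- The counter starts at the numeral 1, because the oracle reserves number 0 for `F`.
  (Code.fold .X (.straight (var 0)) (.straight (.pair (.pair none none) none))
    ((Code.straight (.pair none (hd (var 1)))).pair
      (((Code.straight (.pair (hd (var 1)) (.pair (var 0) none))).seq stackCode).pair
        (.straight (tl (var 1)))))).seq (.straight (.op .snd))

/-- The affine functions of all swaps. -/
noncomputable def collectCode : Code :=
  .fold .X (.straight (var 0)) (.straight none)
    (.fold (.X * .X + 1) (.straight (var 0)) (.straight (var 1))
      (.straight (.pair (hd (var 0)) (var 1))))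

/-- Keep the better one of two pairs. -/
abbrev betterProg (acc c : Prog) : Prog :=
  .ite acc (.ite (bin .lt (hd acc) (hd c)) c acc) c

/-- A bound on the number of affine functions. -/
noncomputable def affsLength : Polynomial ℕ := .X * (.X * .X + 1)

/-- The best rankings. -/
noncomputable def mainCode : Code :=
  (Code.straight (.pair (.op .id) none)).seq <|
  stackListCode.bind <|
  collectCode.bind <|
  (samplesCode 3 affsLength).bind <|
  (Code.fold (samplesLength 3 affsLength) (.straight (var 0)) (.straight none)
    (((Code.straight (.pair (var 0) (.pair (var 4) none))).seq candidateCode).bind <|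
      (Code.straight (.pair
        (bin .add (hd (bin .query none (.pair (hd (var 0)) (hd (tl (var 0))))))
          (hd (tl (tl (var 0)))))
        (tl (tl (tl (var 0)))))).bind
      (.straight (betterProg (var 3) (var 0))))).seq
  (.straight (.op .snd))

section

variable {O : Oracle} {s m n : ℕ} {I : Instance m n}

theorem comp_choose (x : Pt 3) {k : Link n × List (Link n)} (hk : k.2.length ≤ s * s) (Z : Data) :
    Comp O s chooseCode (.pair (ptData x) (.pair (stackData k) Z)) (linkData (chooseAt x k)) := by
  classical
  unfold chooseAt choose
  refine Comp.fold linkData linkData _ (.straight (by simp [Prog.Straight]) rfl) (by simpa using hk)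
    (.straight (by simp [Prog.Straight]) rfl) fun acc k _ => ?_
  refine .straight (by simp [Prog.Straight]) ?_
  by_cases h : 0 < k.aff.eval x <;> simp [Prog.val, Op.eval, linkData, h]

theorem comp_candidate (x : Pt 3) {S : List (Link n × List (Link n))} (hS : S.length ≤ s)
    (hS' : ∀ k ∈ S, k.2.length ≤ s * s) (Z : Data) :
    Comp O s candidateCode (.pair (ptData x) (.pair (listOf stackData S) Z))
      (tallyData (candidate S x)) := by
  refine Comp.fold stackData tallyData (fun c k => c.add (chooseAt x k)) (.straight (by simp) rfl)
    (by simpa using hS) (.straight (by simp [Prog.Straight]) ?_) fun c k hk => ?_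
  · simp [Prog.val, Op.eval, tallyData]
  · refine .bind (.seq (.straight (by simp [Prog.Straight]) rfl)
      (comp_choose x (hS' k hk) .nil)) ?_
    exact .straight (by simp [Prog.Straight]) rfl

theorem input_eq (I : Instance m n) : I.input = listOf I.weights (List.finRange m) := by
  simp only [Instance.input, List.ofFn_eq_map]
  rfl

theorem comp_stackList (hn : 2 ≤ n) (hm : m ≤ s) (hs : n ≤ s) (Z : Data) :
    Comp I.oracle s stackListCode (.pair I.input Z) (listOf stackData (I.stackList hn)) := by
  rw [input_eq]
  refine .seq (y := .pair (.numeral ((List.finRange m).length + 1))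
    (listOf stackData (((List.finRange m).map (I.stack hn)).reverse))) ?_
    (.straight (p := .op .snd) trivial rfl)
  refine Comp.fold_prefix I.weights (fun l₁ => .pair (.numeral (l₁.length + 1))
      (listOf stackData ((l₁.map (I.stack hn)).reverse))) (.straight (by simp) rfl) (by simpa using hm)
      (.straight (by simp [Prog.Straight]) rfl) fun l₁ i l₂ h => ?_
  have hi : l₁.length = i := by
    have h1 : (List.finRange m)[l₁.length]? = some i := by simp [h]
    obtain ⟨h2, h3⟩ := List.getElem?_eq_some_iff.1 h1
    rw [← h3]
    simp
  simp only [List.length_append, List.length_singleton, List.map_append, List.map_singleton,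
    List.reverse_append, List.reverse_singleton, List.singleton_append, listOf_cons, hi]
  refine .pair (.straight (by simp [Prog.Straight]) rfl) (.pair (.seq
    (.straight (by simp [Prog.Straight]) rfl) (comp_stack hn hs .nil))
    (.straight (by simp [Prog.Straight]) rfl))

theorem comp_collect {S : List (Link n × List (Link n))} (hS : S.length ≤ s)
    (hS' : ∀ k ∈ S, k.2.length ≤ s * s) (Z : Data) :
    Comp O s collectCode (.pair (listOf stackData S) Z) (listOf affData (collectAffs S)) := by
  refine Comp.fold stackData (listOf affData) _ (.straight (by simp) rfl) (by simpa using hS)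
    (.straight (by simp [Prog.Straight]) rfl) fun acc k hk => ?_
  refine Comp.fold (l := k.1 :: k.2) linkData (listOf affData) (fun acc k => k.aff :: acc)
    (.straight (by simp) rfl) (by simpa using hS' k hk) (.straight (by simp) rfl) fun acc k _ => ?_
  exact .straight (by simp [Prog.Straight]) rfl

theorem comp_main (hn : 2 ≤ n) {v : ℝ} {R : List (List (Fin n))}
    (h : I.best hn = some (v, R)) :
    Comp I.oracle (m + n) mainCode I.input (listOf orderData R) := by
  have hlen : ∀ k ∈ I.stackList hn, k.2.length ≤ n * n := by
    intro k hk
    simp only [Instance.stackList, List.mem_reverse, List.mem_map] at hk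
    obtain ⟨i, -, rfl⟩ := hk
    simpa [Instance.stack] using Instance.length_chain_le (I := I) i
  have hnn : n * n ≤ (m + n) * (m + n) := Nat.mul_le_mul (by omega) (by omega)
  have hlen' : ∀ k ∈ I.stackList hn, k.2.length ≤ (m + n) * (m + n) := fun k hk =>
    (hlen k hk).trans hnn
  have hS : (I.stackList hn).length ≤ m + n := by simp [Instance.stackList]
  have haffs : (collectAffs (I.stackList hn)).length ≤ affsLength.eval (m + n) := by
    refine (length_collectAffs_le fun k hk => Nat.succ_le_succ (hlen' k hk)).trans ?_
    simp only [affsLength, Polynomial.eval_mul, Polynomial.eval_add, Polynomial.eval_X,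
      Polynomial.eval_one]
    exact Nat.mul_le_mul_right _ hS
  let g : Option (ℝ × List (List (Fin n))) → Data :=
    optionData fun c => .pair (.num c.1) (listOf orderData c.2)
  refine .seq (.straight (y := .pair I.input .nil) (by simp [Prog.Straight]) rfl) ?_
  refine .bind (comp_stackList hn (by omega) (by omega) _) ?_
  refine .bind (comp_collect hS hlen' _) ?_
  refine .bind (comp_samples haffs _) ?_
  refine .seq (y := g (I.best hn)) ?_ (.straight (p := .op .snd) trivial (by rw [h]; rfl))
  refine Comp.fold ptData g
    (fun acc x => better acc (I.evaluate (candidate (I.stackList hn) x)))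
    (.straight (by simp) rfl) (length_samples_le haffs)
    (.straight (p := none) trivial rfl) fun acc x _ => ?_
  refine .bind (.seq (.straight (by simp [Prog.Straight]) rfl)
    (comp_candidate x hS hlen' .nil)) ?_
  refine .bind (.straight (y := .pair
    (.num (I.evaluate (candidate (I.stackList hn) x)).1)
    (listOf orderData (I.evaluate (candidate (I.stackList hn) x)).2)) (by simp [Prog.Straight]) ?_) ?_
  · simp [Prog.val, Op.eval, tallyData, Instance.evaluate, Data.length, Instance.oracle, answer]
  refine .straight (by simp [Prog.Straight]) ?_
  unfold better
  rcases acc with _ | d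
  · simp [Prog.val, g, optionData]
  · by_cases h : d.1 < (I.evaluate (candidate (I.stackList hn) x)).1 <;>
      simp [Prog.val, Op.eval, g, optionData, h]

theorem output_eq (π : Fin m → Equiv.Perm (Fin n)) :
    output π = listOf orderData (List.ofFn fun i => List.ofFn (π i)) := by
  simp only [output, listOf, orderData, List.map_ofFn, Function.comp_def]

end

end MultiRank

theorem theorem2 :
    ∃ (P : MultiRank.Prog) (T : Polynomial ℕ),
      ∀ (m n : ℕ) (I : MultiRank.Instance m n), I.Valid →
        ∃ (π : Fin m → Equiv.Perm (Fin n)) (steps : ℕ),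
          MultiRank.Run I.oracle P I.input (MultiRank.output π) steps ∧
          steps ≤ T.eval (m + n) ∧
          ∃ t : Fin m → Fin (n - 1),
            I.co (fun i => MultiRank.raise (I.w i) (t i)) π ≥ I.coStar I.w := by
  refine ⟨MultiRank.mainCode.prog, MultiRank.mainCode.cost, fun m n I hI => ?_⟩
  obtain ⟨π, t, v, hbest, hle⟩ := hI.best_spec
  obtain ⟨steps, hrun, hsteps⟩ := MultiRank.comp_main hI.two_le hbest
  rw [← MultiRank.output_eq] at hrun
  exact ⟨π, steps, hrun, hsteps, t, hle⟩
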